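/- Let $K$ be an algebraic number field with ring of integers $\mathcal O$, unit group $\mathcal O^*$, and $\mathcal O^\times=\mathcal O\setminus\{0\}$. Let $P_K$ be the group of matrices $\begin{pmatrix}1&y\\0&x\end{pmatrix}$ with $y\in K$, $x\in K^*$, and $P_{\mathcal O}\subset P_K$ the subgroup of those with $y\in\mathcal O$, $x\in\mathcal O^*$; this is a Hecke pair, i.e. every double coset of $P_{\mathcal O}$ contains finitely many right cosets $P_{\mathcal O}\gamma$. Let $\mathcal H=\mathcal H(P_K,P_{\mathcal O})$ be the unital *-algebra of complex $P_{\mathcal O}$-bi-invariant functions on $P_K$ supported on finitely many double cosets, with product $(f*g)(\gamma)=\sum_{\gamma_1\in P_{\mathcal O}\backslash P_K}f(\gamma\gamma_1^{-1})g(\gamma_1)$ and involution $f^*(\gamma)=\overline{f(\gamma^{-1})}$. Let $\lambda(f)\xi=f*\xi$ be the Hecke representation of $\mathcal H$ on $\ell^2(P_{\mathcal O}\backslash P_K)$, and let the Hecke C*-algebra $C^*_r(P_K,P_{\mathcal O})$ be the norm closure of $\lambda(\mathcal H)$. The group $\mathcal O^*$ acts on $K/\mathcal O$ by multiplication; let $\mathcal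 O^*_r$ be the stabilizer of $r\in K/\mathcal O$, which has finite index. For $r\in K/\mathcal O$ let $R(r)$ be the number of right cosets in the double coset $P_{\mathcal O}\begin{pmatrix}1&r\\0&1\end{pmatrix}P_{\mathcal O}$ (which depends only on the class of $r$ modulo $\mathcal O$) and let $\theta_r\in\mathcal H$ be $R(r)^{-1}$ times the characteristic function of this double coset. Let $\mathfrak A$ be the *-subalgebra of $\mathcal H$ generated by all $\theta_r$, $r\in K/\mathcal O$. Consider, for a family $(x_r)_{r\in K/\mathcal O}$ in a unital *-algebra over $\mathbb C$, the relations $$\text{(II)}\qquad x_0=1,\qquad x_{wr}=x_r=x_r^*,\qquad x_rx_s=\frac1{R(r)}\frac1{R(s)}\sum_{u\in\mathcal O^*/\mathcal O^*_r}\ \sum_{v\in\mathcal O^*/\mathcal O^*_s}x_{ur+vs}\qquad(r,s\in K/\mathcal O,\ w\in\mathcal O^*).$$ (1) The $\theta_r$ satisfy (II), and $\mathfrak A$ is universal for (II): for every unital *-algebra $B$ over $\mathbb C$ and every family $(x_r)$ in $B$ satisfying (II) there is a unique unital *-homomorphism $\mathfrak A\to B$ with $\theta_r\mapsto x_r$ for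 all $r$. Moreover $\theta_r$ depends only on the $\mathcal O^*$-orbit of $r$, the $\theta_r$, indexed by the $\mathcal O^*$-orbits in $K/\mathcal O$, form a linear basis of $\mathfrak A$, and $\mathfrak A$ is commutative. (2) For each $d\in\mathcal O^\times$ the linear span $\mathfrak A(d)$ of $\{\theta_r : r\in K,\ rd\in\mathcal O\}$ is a finite-dimensional unital *-subalgebra, and $\mathfrak A=\bigcup_{d\in\mathcal O^\times}\mathfrak A(d)$. (3) $\lambda$ is injective on $\mathfrak A$. Let $A_\theta\subset C^*_r(P_K,P_{\mathcal O})$ be the C*-subalgebra generated by $\lambda(\mathfrak A)$. The $\lambda(\theta_r)$ satisfy (II), and $A_\theta$ is universal for (II) among unital C*-algebras: for every unital C*-algebra $B$ and every family $(x_r)$ in $B$ satisfying (II) there is a unique unital *-homomorphism $A_\theta\to B$ with $\lambda(\theta_r)\mapsto x_r$ for all $r$. (4) Let $\vartheta_r=\frac1{R(r)}\sum_{u\in\mathcal O^*/\mathcal O^*_r}\delta_{ur}\in\mathbb C[K/\mathcal O]$. There is a unique unital *-homomorphism $\mathfrak A\to\mathbb C[K/\mathcal O]$ with $\theta_r\mapsto\vartheta_r$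 for all $r$, and it is injective. There is a unique unital *-homomorphism from $A_\theta$ to the group C*-algebra $C^*(K/\mathcal O)$ (the completion of $\mathbb C[K/\mathcal O]$ in its greatest C*-seminorm) with $\lambda(\theta_r)\mapsto\vartheta_r$ for all $r$, and it is injective and isometric. -/

import Mathlib

open scoped NumberField ComplexConjugate

universe u v w

/-! ### Hecke pairs and Hecke algebras -/

section Hecke

variable {G : Type u} [Group G] (Γ : Subgroup G)

/-- The space `Γ \ G` of right cosets `Γ g`. -/
abbrev RightCosets : Type u := Quotient (QuotientGroup.rightRel Γ)

/-- The right coset `Γ g` as a point of `Γ \ G`. -/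
abbrev mkRightCoset (g : G) : RightCosets Γ := Quotient.mk (QuotientGroup.rightRel Γ) g

/-- The set of right cosets contained in the double coset `Γ g Γ`. -/
def rightCosetsIn (g : G) : Set (RightCosets Γ) :=
  mkRightCoset Γ '' DoubleCoset.doubleCoset g (Γ : Set G) (Γ : Set G)

/-- `R(g)`, the number of right cosets in the double coset `Γ g Γ`. -/
noncomputable def numRightCosets (g : G) : ℕ := (rightCosetsIn Γ g).ncard

/-- `(G, Γ)` is a Hecke pair: every double coset contains finitely many right cosets. -/
class IsHeckePair : Prop where
  finite_rightCosetsIn : ∀ g : G, (rightCosetsIn Γ g).Finite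

/-- The convolution product
`(f * ξ)(γ) = ∑_{γ₁ ∈ Γ \ G} f(γ γ₁⁻¹) ξ(γ₁)`.  In all uses `f` is right invariant and `ξ` is left
invariant under `Γ`, so that the summand depends only on the coset `Γ γ₁`, and the sum is finite. -/
noncomputable def heckeConv (f ξ : G → ℂ) (γ : G) : ℂ :=
  ∑ᶠ q : RightCosets Γ, f (γ * q.out⁻¹) * ξ q.out

/-- Complex functions on `G` which are bi-invariant under `Γ` and supported on finitely many double
cosets. -/
structure IsHeckeFun (f : G → ℂ) : Prop where
  left_inv : ∀ h ∈ Γ, ∀ g, f (h * g) = f g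
  right_inv : ∀ h ∈ Γ, ∀ g, f (g * h) = f g
  finite_supp : ∃ s : Finset G, ∀ g, f g ≠ 0 →
    ∃ a ∈ s, g ∈ DoubleCoset.doubleCoset a (Γ : Set G) (Γ : Set G)

variable {Γ}

theorem mkRightCoset_eq_iff {a b : G} : mkRightCoset Γ a = mkRightCoset Γ b ↔ b * a⁻¹ ∈ Γ := by
  rw [Quotient.eq]
  exact QuotientGroup.rightRel_apply

theorem out_mkRightCoset {M : Type*} {F : G → M} (hF : ∀ h ∈ Γ, ∀ g, F (h * g) = F g) (g : G) :
    F (mkRightCoset Γ g).out = F g := by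
  have h : mkRightCoset Γ (mkRightCoset Γ g).out = mkRightCoset Γ g := Quotient.out_eq _
  rw [mkRightCoset_eq_iff] at h
  have := hF _ h (mkRightCoset Γ g).out
  rw [← this]
  simp

variable (Γ) in
/-- Right translation on right cosets. -/
def rightTranslate (g : G) : RightCosets Γ ≃ RightCosets Γ where
  toFun := Quotient.map (· * g) (by
    intro a b hab
    have := QuotientGroup.rightRel_apply.1 hab
    exact QuotientGroup.rightRel_apply.2 (by simpa [mul_assoc] using this))
  invFun := Quotient.map (· * g⁻¹) (by
    intro a b hab
    have := QuotientGroup.rightRel_apply.1 hab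
    exact QuotientGroup.rightRel_apply.2 (by simpa [mul_assoc] using this))
  left_inv q := by
    induction q using Quotient.inductionOn
    simp
  right_inv q := by
    induction q using Quotient.inductionOn
    simp

theorem rightTranslate_eq (g : G) (q : RightCosets Γ) :
    rightTranslate Γ g q = mkRightCoset Γ (q.out * g) := by
  conv_lhs => rw [← Quotient.out_eq q]
  rfl

theorem out_rightTranslate {M : Type*} {F : G → M} (hF : ∀ h ∈ Γ, ∀ g, F (h * g) = F g) (g : G)
    (q : RightCosets Γ) : F (rightTranslate Γ g q).out = F (q.out * g) := by
  rw [rightTranslate_eq, out_mkRightCoset hF]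

theorem finsum_translate {M : Type*} [AddCommMonoid M] {F : G → M}
    (hF : ∀ h ∈ Γ, ∀ g, F (h * g) = F g) (g : G) :
    ∑ᶠ q : RightCosets Γ, F (q.out * g) = ∑ᶠ q : RightCosets Γ, F q.out := by
  rw [← finsum_comp_equiv (rightTranslate Γ g) (f := fun q => F q.out)]
  exact finsum_congr fun q => (out_rightTranslate hF g q).symm

theorem finite_translate {F : G → ℂ}
    (hF : ∀ h ∈ Γ, ∀ g, F (h * g) = F g) (hfin : {q : RightCosets Γ | F q.out ≠ 0}.Finite) (g : G) :
    {q : RightCosets Γ | F (q.out * g) ≠ 0}.Finite := by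
  have := hfin.preimage (f := rightTranslate Γ g) (rightTranslate Γ g).injective.injOn
  refine this.subset fun q hq => ?_
  simpa [out_rightTranslate hF] using hq

theorem IsHeckeFun.finite [IsHeckePair Γ] {f : G → ℂ} (hf : IsHeckeFun Γ f) :
    {q : RightCosets Γ | f q.out ≠ 0}.Finite := by
  obtain ⟨s, hs⟩ := hf.finite_supp
  refine (s.finite_toSet.biUnion fun a _ => IsHeckePair.finite_rightCosetsIn (Γ := Γ) a).subset ?_
  intro q hq
  obtain ⟨a, ha, hm⟩ := hs _ hq
  exact Set.mem_biUnion ha ⟨q.out, hm, Quotient.out_eq q⟩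

theorem IsHeckeFun.of_finite {f : G → ℂ} (hl : ∀ h ∈ Γ, ∀ g, f (h * g) = f g)
    (hr : ∀ h ∈ Γ, ∀ g, f (g * h) = f g) {s : Set G} (hs : s.Finite)
    (h : ∀ g, f g ≠ 0 → ∃ a ∈ s, g * a⁻¹ ∈ Γ) : IsHeckeFun Γ f := by
  refine ⟨hl, hr, hs.toFinset, fun g hg => ?_⟩
  obtain ⟨a, ha, hm⟩ := h g hg
  exact ⟨a, hs.mem_toFinset.2 ha, DoubleCoset.mem_doubleCoset.2 ⟨_, hm, 1, Γ.one_mem, by simp⟩⟩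

theorem IsHeckeFun.conjInv {f : G → ℂ} (hf : IsHeckeFun Γ f) :
    IsHeckeFun Γ fun g => conj (f g⁻¹) := by
  refine ⟨fun h hh g => ?_, fun h hh g => ?_, ?_⟩
  · simp only [mul_inv_rev]
    rw [hf.right_inv _ (Γ.inv_mem hh)]
  · simp only [mul_inv_rev]
    rw [hf.left_inv _ (Γ.inv_mem hh)]
  · classical
    obtain ⟨s, hs⟩ := hf.finite_supp
    refine ⟨s.image (·⁻¹), fun g hg => ?_⟩
    obtain ⟨a, ha, hm⟩ := hs g⁻¹ (by simpa using hg)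
    refine ⟨a⁻¹, Finset.mem_image_of_mem _ ha, ?_⟩
    obtain ⟨x, hx, y, hy, e⟩ := DoubleCoset.mem_doubleCoset.1 hm
    refine DoubleCoset.mem_doubleCoset.2 ⟨y⁻¹, Γ.inv_mem hy, x⁻¹, Γ.inv_mem hx, ?_⟩
    rw [← inv_inv g, e]
    simp [mul_assoc]

theorem IsHeckeFun.finite_row [IsHeckePair Γ] {f : G → ℂ} (hf : IsHeckeFun Γ f) (γ : G) :
    {q : RightCosets Γ | f (γ * q.out⁻¹) ≠ 0}.Finite := by
  refine (finite_translate (F := fun g => conj (f g⁻¹)) hf.conjInv.left_inv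
    hf.conjInv.finite γ⁻¹).subset fun q hq => ?_
  simpa using hq

theorem IsHeckeFun.finite_col [IsHeckePair Γ] {f : G → ℂ} (hf : IsHeckeFun Γ f) (γ : G) :
    {q : RightCosets Γ | f (q.out * γ) ≠ 0}.Finite :=
  finite_translate hf.left_inv hf.finite γ

theorem IsHeckeFun.finite_supp_mul [IsHeckePair Γ] {f : G → ℂ} (hf : IsHeckeFun Γ f) (ξ : G → ℂ)
    (γ : G) : (Function.support fun q : RightCosets Γ => f (γ * q.out⁻¹) * ξ q.out).Finite :=
  (hf.finite_row γ).subset fun _ hq => left_ne_zero_of_mul hq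

theorem heckeConv_left_inv {f ξ : G → ℂ} (hf : ∀ h ∈ Γ, ∀ g, f (h * g) = f g) :
    ∀ h ∈ Γ, ∀ g, heckeConv Γ f ξ (h * g) = heckeConv Γ f ξ g := by
  intro h hh g
  unfold heckeConv
  refine finsum_congr fun q => ?_
  rw [mul_assoc, hf h hh]

theorem heckeConv_summand_inv {f ξ : G → ℂ} (hf : ∀ h ∈ Γ, ∀ g, f (g * h) = f g)
    (hξ : ∀ h ∈ Γ, ∀ g, ξ (h * g) = ξ g) (γ : G) :
    ∀ h ∈ Γ, ∀ g, f (γ * (h * g)⁻¹) * ξ (h * g) = f (γ * g⁻¹) * ξ g := by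
  intro h hh g
  rw [hξ h hh, mul_inv_rev, ← mul_assoc, hf _ (Γ.inv_mem hh)]

theorem heckeConv_translate {f ξ : G → ℂ} (hf : ∀ h ∈ Γ, ∀ g, f (g * h) = f g)
    (hξ : ∀ h ∈ Γ, ∀ g, ξ (h * g) = ξ g) (γ t : G) :
    heckeConv Γ f ξ (γ * t) = ∑ᶠ q : RightCosets Γ, f (γ * q.out⁻¹) * ξ (q.out * t) := by
  have := finsum_translate (F := fun g => f (γ * t * g⁻¹) * ξ g)
    (heckeConv_summand_inv hf hξ (γ * t)) t
  unfold heckeConv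
  rw [← this]
  refine finsum_congr fun q => ?_
  simp [mul_assoc]

theorem heckeConv_assoc [IsHeckePair Γ] {f g ξ : G → ℂ} (hf : IsHeckeFun Γ f)
    (hg : IsHeckeFun Γ g) :
    heckeConv Γ (heckeConv Γ f g) ξ = heckeConv Γ f (heckeConv Γ g ξ) := by
  funext γ
  have h1 : ∀ q : RightCosets Γ, heckeConv Γ f g (γ * q.out⁻¹) * ξ q.out
      = ∑ᶠ p : RightCosets Γ, f (γ * p.out⁻¹) * (g (p.out * q.out⁻¹) * ξ q.out) := by
    intro q
    rw [heckeConv_translate hf.right_inv hg.left_inv, finsum_mul']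
    · exact finsum_congr fun p => mul_assoc _ _ _
    · exact (hf.finite_row γ).subset fun _ hp => left_ne_zero_of_mul hp
  have h2 : ∀ p : RightCosets Γ, f (γ * p.out⁻¹) * heckeConv Γ g ξ p.out
      = ∑ᶠ q : RightCosets Γ, f (γ * p.out⁻¹) * (g (p.out * q.out⁻¹) * ξ q.out) := by
    intro p
    unfold heckeConv
    rw [mul_finsum']
    exact hg.finite_supp_mul ξ p.out
  have e1 : heckeConv Γ (heckeConv Γ f g) ξ γ = ∑ᶠ q : RightCosets Γ, ∑ᶠ p : RightCosets Γ,
      f (γ * p.out⁻¹) * (g (p.out * q.out⁻¹) * ξ q.out) := finsum_congr h1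
  have e2 : heckeConv Γ f (heckeConv Γ g ξ) γ = ∑ᶠ p : RightCosets Γ, ∑ᶠ q : RightCosets Γ,
      f (γ * p.out⁻¹) * (g (p.out * q.out⁻¹) * ξ q.out) := finsum_congr h2
  rw [e1, e2]
  set P := (hf.finite_row γ).toFinset
  have hP : ∀ q : RightCosets Γ, ∑ᶠ p : RightCosets Γ,
      f (γ * p.out⁻¹) * (g (p.out * q.out⁻¹) * ξ q.out)
      = ∑ p ∈ P, f (γ * p.out⁻¹) * (g (p.out * q.out⁻¹) * ξ q.out) := by
    intro q
    refine finsum_eq_sum_of_support_subset _ fun p hp => ?_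
    simpa [P] using left_ne_zero_of_mul hp
  rw [finsum_congr hP, finsum_sum_comm]
  · refine (finsum_eq_sum_of_support_subset _ fun p hp => ?_).symm
    have : f (γ * p.out⁻¹) ≠ 0 := by
      intro h0
      apply hp
      simp [h0]
    simpa [P] using this
  · intro p _
    exact (hg.finite_supp_mul ξ p.out).subset fun q hq => right_ne_zero_of_mul hq

theorem IsHeckeFun.conv [IsHeckePair Γ] {f g : G → ℂ} (hf : IsHeckeFun Γ f)
    (hg : IsHeckeFun Γ g) : IsHeckeFun Γ (heckeConv Γ f g) := by
  refine IsHeckeFun.of_finite (heckeConv_left_inv hf.left_inv) (fun h hh γ => ?_)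
    (hf.finite.image2 (fun p q => p.out * q.out) hg.finite) fun γ hγ => ?_
  · rw [heckeConv_translate hf.right_inv hg.left_inv]
    exact finsum_congr fun q => by rw [hg.right_inv h hh]
  · have : ∃ q : RightCosets Γ, f (γ * q.out⁻¹) * g q.out ≠ 0 := by
      by_contra! h0
      apply hγ
      simp [heckeConv, h0]
    obtain ⟨q, hq⟩ := this
    have hfq := left_ne_zero_of_mul hq
    have hgq := right_ne_zero_of_mul hq
    refine ⟨_, ⟨mkRightCoset Γ (γ * q.out⁻¹), ?_, q, hgq, rfl⟩, ?_⟩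
    · show f _ ≠ 0
      rwa [out_mkRightCoset hf.left_inv]
    · have h : mkRightCoset Γ (mkRightCoset Γ (γ * q.out⁻¹)).out = mkRightCoset Γ (γ * q.out⁻¹) :=
        Quotient.out_eq _
      rw [mkRightCoset_eq_iff] at h
      simpa [mul_assoc] using h

variable (Γ)

/-- The vector space of `Γ`-bi-invariant functions supported on finitely many double cosets. -/
def heckeSubmodule : Submodule ℂ (G → ℂ) where
  carrier := {f | IsHeckeFun Γ f}
  zero_mem' := ⟨by simp, by simp, ∅, by simp⟩
  add_mem' := by
    classical
    rintro f g hf hg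
    obtain ⟨s, hs⟩ := hf.finite_supp
    obtain ⟨t, ht⟩ := hg.finite_supp
    refine ⟨fun h hh x => ?_, fun h hh x => ?_, s ∪ t, fun x hx => ?_⟩
    · simp [hf.left_inv h hh, hg.left_inv h hh]
    · simp [hf.right_inv h hh, hg.right_inv h hh]
    · by_cases h0 : f x = 0
      · obtain ⟨a, ha, h⟩ := ht x (by simpa [h0] using hx)
        exact ⟨a, Finset.mem_union_right _ ha, h⟩
      · obtain ⟨a, ha, h⟩ := hs x h0
        exact ⟨a, Finset.mem_union_left _ ha, h⟩
  smul_mem' := by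
    rintro c f hf
    obtain ⟨s, hs⟩ := hf.finite_supp
    refine ⟨fun h hh x => ?_, fun h hh x => ?_, s, fun x hx => hs x ?_⟩
    · simp [hf.left_inv h hh]
    · simp [hf.right_inv h hh]
    · exact right_ne_zero_of_mul hx

/-- The Hecke algebra `H(G, Γ)`. -/
def HeckeAlgebra : Type u := heckeSubmodule Γ

namespace HeckeAlgebra

noncomputable instance : AddCommGroup (HeckeAlgebra Γ) :=
  inferInstanceAs (AddCommGroup (heckeSubmodule Γ))

noncomputable instance : Module ℂ (HeckeAlgebra Γ) :=
  inferInstanceAs (Module ℂ (heckeSubmodule Γ))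

instance : CoeFun (HeckeAlgebra Γ) fun _ => G → ℂ := ⟨fun f => f.1⟩

variable {Γ}

theorem isHeckeFun (f : HeckeAlgebra Γ) : IsHeckeFun Γ f := f.2

@[ext]
theorem ext {f g : HeckeAlgebra Γ} (h : ∀ x, f x = g x) : f = g := Subtype.ext (funext h)

@[simp] theorem add_apply (f g : HeckeAlgebra Γ) (x : G) : (f + g) x = f x + g x := rfl
@[simp] theorem zero_apply (x : G) : (0 : HeckeAlgebra Γ) x = 0 := rfl
@[simp] theorem smul_apply (c : ℂ) (f : HeckeAlgebra Γ) (x : G) : (c • f) x = c * f x := rfl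

variable (Γ) in
open Classical in
/-- The characteristic function `[Γ a Γ]` of a double coset. -/
noncomputable def char (a : G) : HeckeAlgebra Γ :=
  ⟨fun g => if g ∈ DoubleCoset.doubleCoset a (Γ : Set G) (Γ : Set G) then 1 else 0, by
    have key : ∀ h ∈ Γ, ∀ k ∈ Γ, ∀ g,
        g ∈ DoubleCoset.doubleCoset a (Γ : Set G) (Γ : Set G) →
        h * g * k ∈ DoubleCoset.doubleCoset a (Γ : Set G) (Γ : Set G) := by
      intro h hh k hk g hg
      obtain ⟨x, hx, y, hy, rfl⟩ := DoubleCoset.mem_doubleCoset.1 hg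
      exact DoubleCoset.mem_doubleCoset.2
        ⟨h * x, Γ.mul_mem hh hx, y * k, Γ.mul_mem hy hk, by simp [mul_assoc]⟩
    refine ⟨fun h hh g => ?_, fun h hh g => ?_, {a}, fun g hg => ⟨a, by simp, ?_⟩⟩
    · refine if_congr ⟨fun H => ?_, fun H => ?_⟩ rfl rfl
      · simpa using key h⁻¹ (Γ.inv_mem hh) 1 Γ.one_mem _ H
      · simpa using key h hh 1 Γ.one_mem _ H
    · refine if_congr ⟨fun H => ?_, fun H => ?_⟩ rfl rfl
      · simpa using key 1 Γ.one_mem h⁻¹ (Γ.inv_mem hh) _ H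
      · simpa using key 1 Γ.one_mem h hh _ H
    · by_contra h0
      simp [h0] at hg⟩

open Classical in
theorem char_one_apply (g : G) : char Γ 1 g = if g ∈ Γ then 1 else 0 := by
  refine if_congr ⟨fun H => ?_, fun H => ?_⟩ rfl rfl
  · obtain ⟨x, hx, y, hy, rfl⟩ := DoubleCoset.mem_doubleCoset.1 H
    simpa using Γ.mul_mem hx hy
  · exact DoubleCoset.mem_doubleCoset.2 ⟨g, H, 1, Γ.one_mem, by simp⟩

theorem one_conv {ξ : G → ℂ} (hξ : ∀ h ∈ Γ, ∀ g, ξ (h * g) = ξ g) :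
    heckeConv Γ (char Γ 1) ξ = ξ := by
  classical
  funext γ
  unfold heckeConv
  rw [finsum_eq_single _ (mkRightCoset Γ γ)]
  · rw [char_one_apply, if_pos, one_mul, out_mkRightCoset hξ]
    exact mkRightCoset_eq_iff.1 (Quotient.out_eq (mkRightCoset Γ γ))
  · intro q hq
    rw [char_one_apply, if_neg, zero_mul]
    intro h
    apply hq
    rw [← Quotient.out_eq q]
    exact mkRightCoset_eq_iff.2 h

theorem conv_one {f : G → ℂ} (hf : ∀ h ∈ Γ, ∀ g, f (g * h) = f g) :
    heckeConv Γ f (char Γ 1) = f := by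
  classical
  funext γ
  unfold heckeConv
  have h1 : mkRightCoset Γ (mkRightCoset Γ (1 : G)).out = mkRightCoset Γ 1 := Quotient.out_eq _
  rw [mkRightCoset_eq_iff, one_mul] at h1
  rw [finsum_eq_single _ (mkRightCoset Γ 1)]
  · rw [char_one_apply, if_pos, mul_one, hf _ h1]
    simpa using Γ.inv_mem h1
  · intro q hq
    rw [char_one_apply, if_neg, mul_zero]
    intro h
    apply hq
    rw [← Quotient.out_eq q]
    exact mkRightCoset_eq_iff.2 (by simpa using h)

/-- The involution `f^*(γ) = conj (f(γ⁻¹))`. -/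
noncomputable instance : Star (HeckeAlgebra Γ) :=
  ⟨fun f => ⟨fun g => conj (f g⁻¹), f.isHeckeFun.conjInv⟩⟩

theorem star_apply (f : HeckeAlgebra Γ) (x : G) : (star f) x = conj (f x⁻¹) := rfl

variable [IsHeckePair Γ]

noncomputable instance : Mul (HeckeAlgebra Γ) :=
  ⟨fun f g => ⟨heckeConv Γ f g, f.isHeckeFun.conv g.isHeckeFun⟩⟩

noncomputable instance : One (HeckeAlgebra Γ) := ⟨char Γ 1⟩

theorem mul_apply (f g : HeckeAlgebra Γ) (x : G) : (f * g) x = heckeConv Γ f g x := rfl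
theorem mul_coe (f g : HeckeAlgebra Γ) : ((f * g : HeckeAlgebra Γ) : G → ℂ) = heckeConv Γ f g := rfl

theorem add_conv (f g : HeckeAlgebra Γ) (ξ : G → ℂ) (x : G) :
    heckeConv Γ (f + g : HeckeAlgebra Γ) ξ x = heckeConv Γ f ξ x + heckeConv Γ g ξ x := by
  unfold heckeConv
  rw [← finsum_add_distrib (f.isHeckeFun.finite_supp_mul ξ x) (g.isHeckeFun.finite_supp_mul ξ x)]
  exact finsum_congr fun q => by rw [add_apply, add_mul]

theorem conv_add (f : HeckeAlgebra Γ) (ξ η : G → ℂ) (x : G) :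
    heckeConv Γ f (ξ + η) x = heckeConv Γ f ξ x + heckeConv Γ f η x := by
  unfold heckeConv
  rw [← finsum_add_distrib (f.isHeckeFun.finite_supp_mul ξ x) (f.isHeckeFun.finite_supp_mul η x)]
  exact finsum_congr fun q => by rw [Pi.add_apply, mul_add]

theorem smul_conv (c : ℂ) (f : HeckeAlgebra Γ) (ξ : G → ℂ) (x : G) :
    heckeConv Γ (c • f : HeckeAlgebra Γ) ξ x = c * heckeConv Γ f ξ x := by
  unfold heckeConv
  rw [mul_finsum' _ _ (f.isHeckeFun.finite_supp_mul ξ x)]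
  exact finsum_congr fun q => by rw [smul_apply, mul_assoc]

theorem conv_smul (c : ℂ) (f : HeckeAlgebra Γ) (ξ : G → ℂ) (x : G) :
    heckeConv Γ f (c • ξ) x = c * heckeConv Γ f ξ x := by
  unfold heckeConv
  rw [mul_finsum' _ _ (f.isHeckeFun.finite_supp_mul ξ x)]
  exact finsum_congr fun q => by rw [Pi.smul_apply, smul_eq_mul, mul_left_comm]

/-- The convolution algebra structure on `H(G, Γ)`; the unit is the characteristic function
of `Γ`. -/
noncomputable instance : Ring (HeckeAlgebra Γ) where
  __ := (inferInstance : AddCommGroup (HeckeAlgebra Γ))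
  left_distrib f g h := ext fun x => conv_add f g h x
  right_distrib f g h := ext fun x => add_conv f g h x
  zero_mul f := ext fun x => by
    simp [mul_apply, heckeConv]
  mul_zero f := ext fun x => by
    rw [mul_apply]
    simp [heckeConv]
  mul_assoc f g h :=
    Subtype.ext (heckeConv_assoc f.isHeckeFun g.isHeckeFun)
  one_mul f := Subtype.ext (one_conv f.isHeckeFun.left_inv)
  mul_one f := Subtype.ext (conv_one f.isHeckeFun.right_inv)

noncomputable instance : Algebra ℂ (HeckeAlgebra Γ) :=
  Algebra.ofModule (fun c f g => ext fun x => smul_conv c f g x)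
    (fun c f g => ext fun x => conv_smul c f g x)

noncomputable instance : StarRing (HeckeAlgebra Γ) where
  star_involutive f := ext fun x => by simp [star_apply]
  star_add f g := ext fun x => by simp [star_apply]
  star_mul f g := ext fun x => by
    rw [star_apply, mul_apply, mul_apply]
    have h := heckeConv_translate f.isHeckeFun.right_inv g.isHeckeFun.left_inv 1 x⁻¹
    rw [one_mul] at h
    rw [h]
    unfold heckeConv
    have hc : ∀ z : RightCosets Γ → ℂ, conj (∑ᶠ q, z q) = ∑ᶠ q, conj (z q) := by
      intro z
      exact (starRingAut (R := ℂ)).toAddEquiv.map_finsum z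
    rw [hc]
    refine finsum_congr fun q => ?_
    simp [star_apply, mul_comm]

instance : StarModule ℂ (HeckeAlgebra Γ) where
  star_smul c f := ext fun x => by simp [star_apply]

end HeckeAlgebra

end Hecke

/-! ### The Hecke representation and the Hecke C*-algebra -/

section HeckeRep

variable {G : Type u} [Group G] (Γ : Subgroup G)

/-- The Hilbert space `ℓ²(Γ \ G)`. -/
abbrev HeckeL2 : Type u := lp (fun _ : RightCosets Γ => ℂ) 2

variable {Γ}

/-- A function on `Γ \ G` viewed as a left `Γ`-invariant function on `G`. -/
def pullback (ξ : RightCosets Γ → ℂ) (g : G) : ℂ := ξ (mkRightCoset Γ g)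

theorem pullback_left_inv (ξ : RightCosets Γ → ℂ) :
    ∀ h ∈ Γ, ∀ g, pullback ξ (h * g) = pullback ξ g := by
  intro h hh g
  unfold pullback
  congr 1
  rw [mkRightCoset_eq_iff]
  simpa using Γ.inv_mem hh

theorem pullback_out (ξ : RightCosets Γ → ℂ) (q : RightCosets Γ) : pullback ξ q.out = ξ q :=
  congrArg ξ (Quotient.out_eq q)

variable [IsHeckePair Γ]

theorem hecke_schur (f : HeckeAlgebra Γ) : ∃ C : ℝ, 0 ≤ C ∧ ∀ (ξ : HeckeL2 Γ)
    (Q : Finset (RightCosets Γ)),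
    ∑ q ∈ Q, ‖heckeConv Γ f (pullback ξ) q.out‖ ^ 2 ≤ C ^ 2 * ‖ξ‖ ^ 2 := by
  classical
  set A : ℝ := ∑ᶠ p : RightCosets Γ, ‖f (p.out)⁻¹‖ with hA
  set B : ℝ := ∑ᶠ q : RightCosets Γ, ‖f q.out‖ with hB
  have hA0 : 0 ≤ A := finsum_nonneg fun _ => norm_nonneg _
  have hB0 : 0 ≤ B := finsum_nonneg fun _ => norm_nonneg _
  have rowSum : ∀ γ : G, ∑ᶠ p : RightCosets Γ, ‖f (γ * p.out⁻¹)‖ = A := by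
    intro γ
    have := finsum_translate (Γ := Γ) (F := fun g => ‖f g⁻¹‖)
      (fun h hh g => by
        simp only [mul_inv_rev]
        rw [f.isHeckeFun.right_inv _ (Γ.inv_mem hh)]) γ⁻¹
    simpa using this
  have colSum : ∀ γ : G, ∑ᶠ q : RightCosets Γ, ‖f (q.out * γ)‖ = B := by
    intro γ
    exact finsum_translate (Γ := Γ) (F := fun g => ‖f g‖)
      (fun h hh g => by simp only [f.isHeckeFun.left_inv _ hh]) γ
  refine ⟨Real.sqrt (A * B), Real.sqrt_nonneg _, fun ξ Q => ?_⟩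
  rw [Real.sq_sqrt (mul_nonneg hA0 hB0)]
  set P : Finset (RightCosets Γ) := Q.biUnion fun q => (f.isHeckeFun.finite_row q.out).toFinset
    with hP
  have memP : ∀ q ∈ Q, ∀ p : RightCosets Γ, f (q.out * p.out⁻¹) ≠ 0 → p ∈ P := by
    intro q hq p hp
    exact Finset.mem_biUnion.2 ⟨q, hq, by simpa using hp⟩
  have rowP : ∀ q ∈ Q, ∑ p ∈ P, ‖f (q.out * p.out⁻¹)‖ = A := by
    intro q hq
    rw [← rowSum q.out]
    refine (finsum_eq_sum_of_support_subset _ fun p hp => ?_).symm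
    exact memP q hq p (by simpa using hp)
  have colQ : ∀ p : RightCosets Γ, ∑ q ∈ Q, ‖f (q.out * p.out⁻¹)‖ ≤ B := by
    intro p
    rw [← colSum p.out⁻¹]
    set S := (f.isHeckeFun.finite_col p.out⁻¹).toFinset with hS
    rw [finsum_eq_sum_of_support_subset (s := Q ∪ S)]
    · exact Finset.sum_le_sum_of_subset_of_nonneg Finset.subset_union_left
        fun _ _ _ => norm_nonneg _
    · intro q hq
      exact Finset.mem_coe.2 (Finset.mem_union_right _ (by simpa [hS] using hq))
  have hrow : ∀ q ∈ Q, ‖heckeConv Γ f (pullback ξ) q.out‖ ^ 2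
      ≤ A * ∑ p ∈ P, ‖f (q.out * p.out⁻¹)‖ * ‖ξ p‖ ^ 2 := by
    intro q hq
    have e : heckeConv Γ f (pullback ξ) q.out = ∑ p ∈ P, f (q.out * p.out⁻¹) * ξ p := by
      unfold heckeConv
      rw [finsum_eq_sum_of_support_subset (s := P)]
      · exact Finset.sum_congr rfl fun p _ => by rw [pullback_out]
      · intro p hp
        exact memP q hq p (left_ne_zero_of_mul hp)
    rw [e, ← rowP q hq]
    calc ‖∑ p ∈ P, f (q.out * p.out⁻¹) * ξ p‖ ^ 2
        ≤ (∑ p ∈ P, ‖f (q.out * p.out⁻¹)‖ * ‖ξ p‖) ^ 2 := by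
          gcongr
          refine (norm_sum_le _ _).trans (le_of_eq ?_)
          exact Finset.sum_congr rfl fun p _ => norm_mul _ _
      _ ≤ _ := by
          refine Finset.sum_sq_le_sum_mul_sum_of_sq_le_mul P (fun p _ => norm_nonneg _)
            (fun p _ => mul_nonneg (norm_nonneg _) (sq_nonneg _)) fun p _ => le_of_eq (by ring)
  have hξ : ∑ p ∈ P, ‖ξ p‖ ^ 2 ≤ ‖ξ‖ ^ 2 := by
    have := lp.sum_rpow_le_norm_rpow (p := 2) (by simp) ξ P
    simpa using this
  calc ∑ q ∈ Q, ‖heckeConv Γ f (pullback ξ) q.out‖ ^ 2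
      ≤ ∑ q ∈ Q, A * ∑ p ∈ P, ‖f (q.out * p.out⁻¹)‖ * ‖ξ p‖ ^ 2 := Finset.sum_le_sum hrow
    _ = A * ∑ p ∈ P, (∑ q ∈ Q, ‖f (q.out * p.out⁻¹)‖) * ‖ξ p‖ ^ 2 := by
        rw [← Finset.mul_sum, Finset.sum_comm]
        simp_rw [Finset.sum_mul]
    _ ≤ A * ∑ p ∈ P, B * ‖ξ p‖ ^ 2 := by
        gcongr with p _
        exact colQ p
    _ = A * B * ∑ p ∈ P, ‖ξ p‖ ^ 2 := by rw [← Finset.mul_sum, mul_assoc]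
    _ ≤ A * B * ‖ξ‖ ^ 2 := by gcongr

/-- The operator `ξ ↦ f * ξ` of left convolution by `f` on `ℓ²(Γ \ G)`. -/
noncomputable def heckeOp (f : HeckeAlgebra Γ) : HeckeL2 Γ →L[ℂ] HeckeL2 Γ :=
  LinearMap.mkContinuousOfExistsBound
    { toFun := fun ξ => ⟨fun q => heckeConv Γ f (pullback ξ) q.out, by
        obtain ⟨C, _, hC⟩ := hecke_schur f
        refine memℓp_gen' (C := C ^ 2 * ‖ξ‖ ^ 2) fun Q => ?_
        simpa using hC ξ Q⟩
      map_add' := fun ξ η => lp.ext (funext fun q =>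
        HeckeAlgebra.conv_add f (pullback ξ) (pullback η) q.out)
      map_smul' := fun c ξ => lp.ext (funext fun q =>
        HeckeAlgebra.conv_smul c f (pullback ξ) q.out) }
    (by
      obtain ⟨C, hC0, hC⟩ := hecke_schur f
      refine ⟨C, fun ξ => lp.norm_le_of_forall_sum_le (p := 2) (by simp) (by positivity)
        fun Q => ?_⟩
      simpa [mul_pow] using hC ξ Q)

theorem heckeOp_apply (f : HeckeAlgebra Γ) (ξ : HeckeL2 Γ) (q : RightCosets Γ) :
    heckeOp f ξ q = heckeConv Γ f (pullback ξ) q.out := rfl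

theorem pullback_heckeOp (f : HeckeAlgebra Γ) (ξ : HeckeL2 Γ) :
    pullback (heckeOp f ξ) = heckeConv Γ f (pullback ξ) := by
  funext g
  exact out_mkRightCoset (heckeConv_left_inv f.isHeckeFun.left_inv) g

open Classical in
theorem heckeOp_single (f : HeckeAlgebra Γ) (p q : RightCosets Γ) (c : ℂ) :
    heckeOp f (lp.single 2 p c) q = f (q.out * p.out⁻¹) * c := by
  rw [heckeOp_apply]
  unfold heckeConv
  rw [finsum_eq_single _ p]
  · rw [pullback_out]
    simp
  · intro r hr
    rw [pullback_out, lp.single_apply_ne _ _ _ hr, mul_zero]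

open Classical in
theorem heckeOp_star (f : HeckeAlgebra Γ) : heckeOp (star f) = star (heckeOp f) := by
  have hs : ∀ (T : HeckeL2 Γ →L[ℂ] HeckeL2 Γ) (ξ : HeckeL2 Γ),
      HasSum (fun p => T (lp.single 2 p (ξ p))) (T ξ) := by
    intro T ξ
    exact (lp.hasSum_single (p := 2) (by simp) ξ).mapL T
  refine ContinuousLinearMap.ext fun ξ => ?_
  refine (hs _ ξ).unique ?_
  convert hs (star (heckeOp f)) ξ using 2 with p
  refine lp.ext (funext fun q => ?_)
  have h1 : ∀ η : HeckeL2 Γ, η q = inner ℂ (lp.single 2 q (1 : ℂ)) η := by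
    intro η
    rw [lp.inner_single_left]
    simp
  rw [h1 (star (heckeOp f) _), ContinuousLinearMap.star_eq_adjoint,
    ContinuousLinearMap.adjoint_inner_right, lp.inner_single_right, heckeOp_single, heckeOp_single]
  simp [HeckeAlgebra.star_apply, mul_comm]

variable (Γ) in
/-- The Hecke representation `λ` of `H(G, Γ)` on `ℓ²(Γ \ G)`, `λ(f) ξ = f * ξ`. -/
noncomputable def heckeRep : HeckeAlgebra Γ →⋆ₐ[ℂ] (HeckeL2 Γ →L[ℂ] HeckeL2 Γ) where
  toFun := heckeOp
  map_one' := ContinuousLinearMap.ext fun ξ => lp.ext (funext fun q => by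
    rw [heckeOp_apply]
    exact (congrFun (HeckeAlgebra.one_conv (pullback_left_inv _)) _).trans (pullback_out _ _))
  map_mul' f g := ContinuousLinearMap.ext fun ξ => lp.ext (funext fun q => by
    rw [mul_apply_eq_comp, heckeOp_apply, heckeOp_apply, pullback_heckeOp]
    exact congrFun (heckeConv_assoc f.isHeckeFun g.isHeckeFun) q.out)
  map_zero' := ContinuousLinearMap.ext fun ξ => lp.ext (funext fun q => by
    rw [heckeOp_apply]
    simp [heckeConv])
  map_add' f g := ContinuousLinearMap.ext fun ξ => lp.ext (funext fun q =>
    HeckeAlgebra.add_conv f g (pullback ξ) q.out)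
  commutes' c := ContinuousLinearMap.ext fun ξ => lp.ext (funext fun q => by
    rw [Algebra.algebraMap_eq_smul_one, heckeOp_apply, HeckeAlgebra.smul_conv]
    rw [show heckeConv Γ (1 : HeckeAlgebra Γ) (pullback ξ) q.out = ξ q from
      (congrFun (HeckeAlgebra.one_conv (pullback_left_inv _)) _).trans (pullback_out _ _)]
    rfl)
  map_star' := heckeOp_star

variable (Γ) in
/-- The Hecke C*-algebra `C*_r(G, Γ)`: the norm closure of the image of the Hecke representation. -/
noncomputable def heckeCStar : StarSubalgebra ℂ (HeckeL2 Γ →L[ℂ] HeckeL2 Γ) :=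
  (heckeRep Γ).range.topologicalClosure

end HeckeRep

/-! ### Group algebras and group C*-algebras of (discrete, additively written) abelian groups -/

section GroupCStar

variable (D : Type u) [AddCommGroup D]

namespace GroupAlg

variable {D}

/-- The involution on the complex group algebra: `(∑ c_g δ_g)^* = ∑ conj(c_g) δ_{-g}`. -/
noncomputable instance : Star (AddMonoidAlgebra ℂ D) :=
  ⟨fun f => AddMonoidAlgebra.ofCoeff
    ((f.coeff.mapRange (starRingEnd ℂ) (map_zero _)).equivMapDomain (Equiv.neg D))⟩

theorem coeff_star (f : AddMonoidAlgebra ℂ D) (g : D) :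
    (star f).coeff g = conj (f.coeff (-g)) := rfl

theorem star_single (g : D) (c : ℂ) :
    star (AddMonoidAlgebra.single g c) = AddMonoidAlgebra.single (-g) (conj c) := by
  classical
  ext h
  rw [coeff_star, AddMonoidAlgebra.coeff_single, AddMonoidAlgebra.coeff_single,
    Finsupp.single_apply, Finsupp.single_apply]
  by_cases e : g = -h
  · rw [if_pos e, if_pos (by rw [e, neg_neg])]
  · rw [if_neg e, if_neg (fun e' => e (by rw [← e', neg_neg])), map_zero]

theorem star_add' (f g : AddMonoidAlgebra ℂ D) : star (f + g) = star f + star g := by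
  ext h
  simp [coeff_star]

noncomputable instance : StarRing (AddMonoidAlgebra ℂ D) where
  star_involutive f := by
    ext h
    simp [coeff_star]
  star_add := star_add'
  star_mul f g := by
    induction f using AddMonoidAlgebra.induction_linear with
    | zero =>
      have : star (0 : AddMonoidAlgebra ℂ D) = 0 := by ext h; simp [coeff_star]
      simp [this]
    | add f f' hf hf' => rw [add_mul, star_add', hf, hf', star_add', mul_add]
    | single a c =>
      induction g using AddMonoidAlgebra.induction_linear with
      | zero =>
        have : star (0 : AddMonoidAlgebra ℂ D) = 0 := by ext h; simp [coeff_star]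
        simp [this]
      | add f f' hf hf' => rw [mul_add, star_add', hf, hf', star_add', add_mul]
      | single b d =>
        rw [AddMonoidAlgebra.single_mul_single, star_single, star_single, star_single,
          AddMonoidAlgebra.single_mul_single, map_mul, mul_comm (conj c), neg_add_rev]

instance : StarModule ℂ (AddMonoidAlgebra ℂ D) where
  star_smul c f := by
    ext h
    simp [coeff_star]

end GroupAlg

/-- C*-seminorms on the group algebra. -/
structure IsCStarSeminorm (p : Seminorm ℂ (AddMonoidAlgebra ℂ D)) : Prop where
  mul_le : ∀ a b, p (a * b) ≤ p a * p b
  star_mul_self : ∀ a, p (star a * a) = p a ^ 2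

/-- The index type of all C*-seminorms on the group algebra. -/
def CStarSeminorm : Type u := {p : Seminorm ℂ (AddMonoidAlgebra ℂ D) // IsCStarSeminorm D p}

variable {D}

theorem IsCStarSeminorm.one_le {p : Seminorm ℂ (AddMonoidAlgebra ℂ D)} (hp : IsCStarSeminorm D p) :
    p 1 ≤ 1 := by
  have h := hp.star_mul_self 1
  rw [star_one, one_mul] at h
  nlinarith [apply_nonneg p 1]

theorem IsCStarSeminorm.single_le {p : Seminorm ℂ (AddMonoidAlgebra ℂ D)}
    (hp : IsCStarSeminorm D p) (g : D) (c : ℂ) : p (AddMonoidAlgebra.single g c) ≤ ‖c‖ := by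
  have h := hp.star_mul_self (AddMonoidAlgebra.single g 1)
  rw [GroupAlg.star_single, AddMonoidAlgebra.single_mul_single, neg_add_cancel, map_one, one_mul,
    ← AddMonoidAlgebra.one_def] at h
  have h1 : p (AddMonoidAlgebra.single g 1) ≤ 1 := by
    have := hp.one_le
    nlinarith [apply_nonneg p (AddMonoidAlgebra.single g 1)]
  have e : AddMonoidAlgebra.single g c = c • AddMonoidAlgebra.single g (1 : ℂ) := by
    rw [AddMonoidAlgebra.smul_single, smul_eq_mul, mul_one]
  rw [e, map_smul_eq_mul]
  exact mul_le_of_le_one_right (norm_nonneg _) h1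

theorem IsCStarSeminorm.star_le {p : Seminorm ℂ (AddMonoidAlgebra ℂ D)}
    (hp : IsCStarSeminorm D p) (a : AddMonoidAlgebra ℂ D) : p a ≤ p (star a) := by
  have h := hp.star_mul_self a
  have h2 := hp.mul_le (star a) a
  rcases (apply_nonneg p a).eq_or_lt with h0 | h0
  · rw [← h0]
    exact apply_nonneg _ _
  · nlinarith

theorem cstarSeminorm_bddAbove (f : AddMonoidAlgebra ℂ D) :
    BddAbove (Set.range fun p : CStarSeminorm D => p.1 f) := by
  induction f using AddMonoidAlgebra.induction_linear with
  | zero =>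
    refine ⟨0, ?_⟩
    rintro _ ⟨p, rfl⟩
    simp
  | add f g hf hg =>
    obtain ⟨a, ha⟩ := hf
    obtain ⟨b, hb⟩ := hg
    refine ⟨a + b, ?_⟩
    rintro _ ⟨p, rfl⟩
    exact (map_add_le_add p.1 f g).trans (add_le_add (ha ⟨p, rfl⟩) (hb ⟨p, rfl⟩))
  | single g c =>
    refine ⟨‖c‖, ?_⟩
    rintro _ ⟨p, rfl⟩
    exact p.2.single_le g c

instance : Nonempty (CStarSeminorm D) := ⟨⟨0, by simp, by simp⟩⟩

/-- The greatest C*-seminorm on the group algebra: the supremum of all C*-seminorms. -/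
noncomputable def maxCStarNorm (f : AddMonoidAlgebra ℂ D) : ℝ := ⨆ p : CStarSeminorm D, p.1 f

theorem le_maxCStarNorm (p : CStarSeminorm D) (f : AddMonoidAlgebra ℂ D) :
    p.1 f ≤ maxCStarNorm f := le_ciSup (cstarSeminorm_bddAbove f) p

theorem maxCStarNorm_nonneg (f : AddMonoidAlgebra ℂ D) : 0 ≤ maxCStarNorm f :=
  Real.iSup_nonneg fun p => apply_nonneg p.1 f

theorem maxCStarNorm_mul_le (f g : AddMonoidAlgebra ℂ D) :
    maxCStarNorm (f * g) ≤ maxCStarNorm f * maxCStarNorm g :=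
  ciSup_le fun p => (p.2.mul_le f g).trans (mul_le_mul (le_maxCStarNorm p f)
    (le_maxCStarNorm p g) (apply_nonneg _ _) (maxCStarNorm_nonneg f))

theorem maxCStarNorm_smul (c : ℂ) (f : AddMonoidAlgebra ℂ D) :
    maxCStarNorm (c • f) = ‖c‖ * maxCStarNorm f := by
  unfold maxCStarNorm
  rw [Real.mul_iSup_of_nonneg (norm_nonneg c)]
  exact iSup_congr fun p => map_smul_eq_mul p.1 c f

theorem maxCStarNorm_star_mul_self (f : AddMonoidAlgebra ℂ D) :
    maxCStarNorm f * maxCStarNorm f ≤ maxCStarNorm (star f * f) := by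
  have h : maxCStarNorm f ≤ Real.sqrt (maxCStarNorm (star f * f)) := by
    refine ciSup_le fun p => Real.le_sqrt_of_sq_le ?_
    rw [← p.2.star_mul_self]
    exact le_maxCStarNorm p _
  calc _ ≤ Real.sqrt (maxCStarNorm (star f * f)) * Real.sqrt (maxCStarNorm (star f * f)) :=
        mul_le_mul h h (maxCStarNorm_nonneg f) (Real.sqrt_nonneg _)
    _ = _ := Real.mul_self_sqrt (maxCStarNorm_nonneg _)

theorem maxCStarNorm_star_le (f : AddMonoidAlgebra ℂ D) :
    maxCStarNorm (star f) ≤ maxCStarNorm f := by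
  refine ciSup_le fun p => (p.2.star_le (star f)).trans ?_
  rw [star_star]
  exact le_maxCStarNorm p f

variable (D)

/-- The group algebra equipped with its greatest C*-seminorm. -/
def PreGroupCStar : Type u := AddMonoidAlgebra ℂ D

namespace PreGroupCStar

noncomputable instance : CommRing (PreGroupCStar D) :=
  inferInstanceAs (CommRing (AddMonoidAlgebra ℂ D))

noncomputable instance : Algebra ℂ (PreGroupCStar D) :=
  inferInstanceAs (Algebra ℂ (AddMonoidAlgebra ℂ D))

noncomputable instance : StarRing (PreGroupCStar D) :=
  inferInstanceAs (StarRing (AddMonoidAlgebra ℂ D))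

instance : StarModule ℂ (PreGroupCStar D) :=
  inferInstanceAs (StarModule ℂ (AddMonoidAlgebra ℂ D))

/-- The greatest C*-seminorm as a seminorm of the additive group. -/
noncomputable def addGroupSeminorm : AddGroupSeminorm (PreGroupCStar D) where
  toFun := fun f => maxCStarNorm (D := D) f
  map_zero' := by
    have := maxCStarNorm_smul (0 : ℂ) (0 : AddMonoidAlgebra ℂ D)
    rw [zero_smul, norm_zero, zero_mul] at this
    exact this
  add_le' f g := ciSup_le fun p => (map_add_le_add p.1 f g).trans
    (add_le_add (le_maxCStarNorm p f) (le_maxCStarNorm p g))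
  neg' f := by
    have := maxCStarNorm_smul (-1 : ℂ) (show AddMonoidAlgebra ℂ D from f)
    rw [neg_smul, one_smul, norm_neg, norm_one, one_mul] at this
    exact this

noncomputable instance : SeminormedCommRing (PreGroupCStar D) where
  __ := (inferInstance : CommRing (PreGroupCStar D))
  __ := (addGroupSeminorm D).toSeminormedAddCommGroup
  norm_mul_le f g := maxCStarNorm_mul_le (D := D) f g

theorem norm_def (f : PreGroupCStar D) : ‖f‖ = maxCStarNorm (D := D) f := rfl

noncomputable instance : NormedAlgebra ℂ (PreGroupCStar D) where
  __ := (inferInstance : Algebra ℂ (PreGroupCStar D))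
  norm_smul_le c f := (maxCStarNorm_smul (D := D) c f).le

theorem norm_star_le (f : PreGroupCStar D) : ‖star f‖ ≤ ‖f‖ := maxCStarNorm_star_le (D := D) f

theorem norm_star_mul_self (f : PreGroupCStar D) : ‖f‖ * ‖f‖ ≤ ‖star f * f‖ :=
  maxCStarNorm_star_mul_self (D := D) f

theorem uniformContinuous_star : UniformContinuous (star : PreGroupCStar D → PreGroupCStar D) := by
  refine (LipschitzWith.of_dist_le_mul (K := 1) fun f g => ?_).uniformContinuous
  rw [dist_eq_norm, dist_eq_norm, ← star_sub, NNReal.coe_one, one_mul]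
  exact norm_star_le D _

end PreGroupCStar

/-- The (full) group C*-algebra `C*(D)` of the discrete abelian group `D`: the completion of the
group algebra `ℂ[D]` in its greatest C*-seminorm. -/
def GroupCStar : Type u := UniformSpace.Completion (PreGroupCStar D)

namespace GroupCStar

open UniformSpace

noncomputable instance : NormedCommRing (GroupCStar D) :=
  inferInstanceAs (NormedCommRing (Completion (PreGroupCStar D)))

noncomputable instance : NormedAlgebra ℂ (GroupCStar D) :=
  inferInstanceAs (NormedAlgebra ℂ (Completion (PreGroupCStar D)))

instance : CompleteSpace (GroupCStar D) :=
  inferInstanceAs (CompleteSpace (Completion (PreGroupCStar D)))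

variable {D}

/-- The canonical map from the group algebra. -/
noncomputable def ofPre (f : PreGroupCStar D) : GroupCStar D := (f : Completion (PreGroupCStar D))

theorem continuous_ofPre : Continuous (ofPre (D := D)) := Completion.continuous_coe _

theorem norm_ofPre (f : PreGroupCStar D) : ‖ofPre f‖ = ‖f‖ := Completion.norm_coe f

theorem ofPre_add (f g : PreGroupCStar D) : ofPre (f + g) = ofPre f + ofPre g :=
  Completion.coe_add f g

theorem ofPre_mul (f g : PreGroupCStar D) : ofPre (f * g) = ofPre f * ofPre g :=
  Completion.coe_mul f g

theorem ofPre_smul (c : ℂ) (f : PreGroupCStar D) : ofPre (c • f) = c • ofPre f :=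
  Completion.coe_smul c f

theorem induction {P : GroupCStar D → Prop} (x : GroupCStar D) (hc : IsClosed {x | P x})
    (h : ∀ f, P (ofPre f)) : P x := Completion.induction_on x hc h

theorem induction₂ {P : GroupCStar D → GroupCStar D → Prop} (x y : GroupCStar D)
    (hc : IsClosed {z : GroupCStar D × GroupCStar D | P z.1 z.2})
    (h : ∀ f g, P (ofPre f) (ofPre g)) : P x y := Completion.induction_on₂ x y hc h

/-- The involution, extended from the group algebra by continuity. -/
noncomputable instance : Star (GroupCStar D) :=
  ⟨Completion.map (star : PreGroupCStar D → PreGroupCStar D)⟩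

theorem star_ofPre (f : PreGroupCStar D) : star (ofPre f) = ofPre (star f) :=
  Completion.map_coe (PreGroupCStar.uniformContinuous_star D) f

@[fun_prop]
theorem continuous_star' : Continuous fun x : GroupCStar D => star x :=
  Completion.continuous_map

theorem star_smul_aux (c : ℂ) (x : GroupCStar D) : star (c • x) = star c • star x := by
  have h1 : Continuous fun x : GroupCStar D => star (c • x) :=
    continuous_star'.comp (continuous_const_smul c)
  have h2 : Continuous fun x : GroupCStar D => star c • star x :=
    continuous_star'.const_smul (star c)
  refine induction (P := fun x => star (c • x) = star c • star x) x (isClosed_eq h1 h2) fun f => ?_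
  rw [← ofPre_smul, star_ofPre, star_ofPre, star_smul, ofPre_smul]

noncomputable instance : CStarAlgebra (GroupCStar D) where
  __ := (inferInstance : NormedCommRing (GroupCStar D))
  __ := (inferInstance : NormedAlgebra ℂ (GroupCStar D))
  __ := (inferInstance : CompleteSpace (GroupCStar D))
  star_involutive x := by
    refine induction (P := fun x => star (star x) = x) x ?_ fun f => ?_
    · exact isClosed_eq (by fun_prop) (by fun_prop)
    · rw [star_ofPre, star_ofPre, star_star]
  star_mul x y := by
    refine induction₂ (P := fun x y => star (x * y) = star y * star x) x y ?_ fun f g => ?_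
    · exact isClosed_eq (by fun_prop) (by fun_prop)
    · rw [← ofPre_mul, star_ofPre, star_ofPre, star_ofPre, star_mul, ofPre_mul]
  star_add x y := by
    refine induction₂ (P := fun x y => star (x + y) = star x + star y) x y ?_ fun f g => ?_
    · exact isClosed_eq (by fun_prop) (by fun_prop)
    · rw [← ofPre_add, star_ofPre, star_ofPre, star_ofPre, star_add, ofPre_add]
  norm_mul_self_le x := by
    refine induction (P := fun x => ‖x‖ * ‖x‖ ≤ ‖star x * x‖) x ?_ fun f => ?_
    · exact isClosed_le (by fun_prop) (by fun_prop)
    · rw [star_ofPre, ← ofPre_mul, norm_ofPre, norm_ofPre]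
      exact PreGroupCStar.norm_star_mul_self D f
  star_smul c x := star_smul_aux c x

variable (D) in
/-- The canonical *-homomorphism `ℂ[D] → C*(D)`. -/
noncomputable def ofGroupAlg : AddMonoidAlgebra ℂ D →⋆ₐ[ℂ] GroupCStar D where
  toFun f := ofPre (show PreGroupCStar D from f)
  map_one' := rfl
  map_mul' f g := ofPre_mul (D := D) f g
  map_zero' := rfl
  map_add' f g := ofPre_add (D := D) f g
  commutes' c := by
    rw [Algebra.algebraMap_eq_smul_one, Algebra.algebraMap_eq_smul_one]
    exact ofPre_smul (D := D) c 1
  map_star' f := (star_ofPre (D := D) f).symm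

end GroupCStar

end GroupCStar

/-! ### The `ax + b` groups of a number field -/

/-- The group `P_F` of matrices `(1 y; 0 x)` with `y ∈ F` and `x ∈ Fˣ`, under matrix
multiplication. -/
@[ext]
structure AffGroup (F : Type u) [Field F] : Type u where
  /-- the upper right entry -/
  y : F
  /-- the lower right entry -/
  x : Fˣ

namespace AffGroup

variable {F : Type u} [Field F]

instance : Mul (AffGroup F) := ⟨fun g h => ⟨h.y + g.y * h.x, g.x * h.x⟩⟩
instance : One (AffGroup F) := ⟨⟨0, 1⟩⟩
instance : Inv (AffGroup F) := ⟨fun g => ⟨-(g.y * (g.x⁻¹ : Fˣ)), g.x⁻¹⟩⟩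

@[simp] theorem mul_y (g h : AffGroup F) : (g * h).y = h.y + g.y * h.x := rfl
@[simp] theorem mul_x (g h : AffGroup F) : (g * h).x = g.x * h.x := rfl
@[simp] theorem one_y : (1 : AffGroup F).y = 0 := rfl
@[simp] theorem one_x : (1 : AffGroup F).x = 1 := rfl
@[simp] theorem inv_y (g : AffGroup F) : (g⁻¹).y = -(g.y * (g.x⁻¹ : Fˣ)) := rfl
@[simp] theorem inv_x (g : AffGroup F) : (g⁻¹).x = g.x⁻¹ := rfl

instance : Group (AffGroup F) :=
  Group.ofLeftAxioms
    (fun a b c => AffGroup.ext (by simp only [mul_y, mul_x, Units.val_mul]; ring)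
      (by simp only [mul_x, mul_assoc]))
    (fun a => AffGroup.ext (by simp) (by simp))
    (fun a => AffGroup.ext (by simp) (by simp))

/-- The matrix `(1 y; 0 x)`. -/
def toMatrix (g : AffGroup F) : Matrix (Fin 2) (Fin 2) F := !![1, g.y; 0, (g.x : F)]

theorem toMatrix_mul (g h : AffGroup F) : toMatrix (g * h) = toMatrix g * toMatrix h := by
  simp [toMatrix]

end AffGroup

section NumberField

variable (K : Type u) [Field K]

/-- The subgroup `P_𝓞` of `P_K`: matrices `(1 a; 0 u)` with `a ∈ 𝓞` and `u ∈ 𝓞ˣ`. -/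
def intAffGroup : Subgroup (AffGroup K) where
  carrier := {g | (∃ a : 𝓞 K, (a : K) = g.y) ∧ ∃ u : (𝓞 K)ˣ, ((u : 𝓞 K) : K) = g.x}
  one_mem' := ⟨⟨0, by simp⟩, 1, by simp⟩
  mul_mem' := by
    rintro g h ⟨⟨a, ha⟩, u, hu⟩ ⟨⟨b, hb⟩, v, hv⟩
    exact ⟨⟨b + a * v, by simp [ha, hb, hv]⟩, u * v, by simp [hu, hv]⟩
  inv_mem' := by
    rintro g ⟨⟨a, ha⟩, u, hu⟩
    have hi : (((u⁻¹ : (𝓞 K)ˣ) : 𝓞 K) : K) = ((g.x⁻¹ : Kˣ) : K) := by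
      rw [Units.val_inv_eq_inv_val, ← hu]
      refine eq_inv_of_mul_eq_one_left ?_
      rw [← map_mul, Units.inv_mul, map_one]
    exact ⟨⟨-(a * (u⁻¹ : (𝓞 K)ˣ)), by simp [ha, hi]⟩, u⁻¹, hi⟩

/-- `𝓞` as an `𝓞`-submodule of `K`. -/
abbrev intSubmodule : Submodule (𝓞 K) K := LinearMap.range (Algebra.linearMap (𝓞 K) K)

/-- The quotient `K/𝓞`, an `𝓞`-module on which `𝓞ˣ` acts by multiplication.  The group `𝓞ˣ_r` of
units fixing `r` modulo `𝓞` is `MulAction.stabilizer (𝓞 K)ˣ r`. -/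
abbrev KModO : Type u := K ⧸ intSubmodule K

variable {K}

/-- The class of `y ∈ K` in `K/𝓞`. -/
abbrev KModO.mk (y : K) : KModO K := (intSubmodule K).mkQ y

theorem KModO.mk_eq_iff {y z : K} : KModO.mk y = KModO.mk z ↔ ∃ a : 𝓞 K, (a : K) = y - z := by
  exact Submodule.Quotient.eq (intSubmodule K)

/-- The matrix `(1 y; 0 1)`. -/
def transl (y : K) : AffGroup K := ⟨y, 1⟩

theorem doubleCoset_transl {y z : K} (h : KModO.mk y = KModO.mk z) :
    DoubleCoset.doubleCoset (transl y) (intAffGroup K : Set (AffGroup K)) (intAffGroup K)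
      = DoubleCoset.doubleCoset (transl z) (intAffGroup K : Set (AffGroup K)) (intAffGroup K) := by
  obtain ⟨a, ha⟩ := KModO.mk_eq_iff.1 h
  refine DoubleCoset.doubleCoset_eq_of_mem (DoubleCoset.mem_doubleCoset.2
    ⟨transl (a : K), ⟨⟨a, rfl⟩, 1, by simp [transl]⟩, 1, (intAffGroup K).one_mem, ?_⟩)
  ext
  · simp [transl, ha]
  · simp [transl]

theorem char_transl {y z : K} (h : KModO.mk y = KModO.mk z) :
    HeckeAlgebra.char (intAffGroup K) (transl y) = HeckeAlgebra.char (intAffGroup K) (transl z) := by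
  classical
  refine HeckeAlgebra.ext fun g => ?_
  exact if_congr (by rw [doubleCoset_transl h]) rfl rfl

theorem numRightCosets_transl {y z : K} (h : KModO.mk y = KModO.mk z) :
    numRightCosets (intAffGroup K) (transl y) = numRightCosets (intAffGroup K) (transl z) := by
  simp only [numRightCosets, rightCosetsIn, doubleCoset_transl h]

variable [NumberField K]

/-- A finiteness principle: a map on `𝓞 × 𝓞ˣ` which only depends on residues modulo a
nonzero `n ∈ 𝓞` has finite range. -/
theorem finite_range_of_mod {α : Type*} (F : 𝓞 K × (𝓞 K)ˣ → α) {n : 𝓞 K} (hn : n ≠ 0)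
    (hF : ∀ (a : 𝓞 K) (u : (𝓞 K)ˣ) (b : 𝓞 K) (v : (𝓞 K)ˣ), n ∣ b - a → n ∣ (v : 𝓞 K) - (u : 𝓞 K) → F (a, u) = F (b, v)) :
    (Set.range F).Finite := by
  have hI : Ideal.span {n} ≠ ⊥ := by simpa using hn
  have : Finite (𝓞 K ⧸ Ideal.span {n}) := Ideal.finiteQuotientOfFreeOfNeBot _ hI
  let π : 𝓞 K × (𝓞 K)ˣ → (𝓞 K ⧸ Ideal.span {n}) × (𝓞 K ⧸ Ideal.span {n}) :=
    fun p => (Ideal.Quotient.mk _ p.1, Ideal.Quotient.mk _ (p.2 : 𝓞 K))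
  have key : ∀ p q, π p = π q → F p = F q := by
    rintro ⟨a, u⟩ ⟨b, v⟩ h
    have h1 := (Ideal.Quotient.eq.1 (congrArg Prod.fst h).symm)
    have h2 := (Ideal.Quotient.eq.1 (congrArg Prod.snd h).symm)
    exact hF a u b v (Ideal.mem_span_singleton.1 h1) (Ideal.mem_span_singleton.1 h2)
  have : Set.range F ⊆ Set.range fun z : Set.range π => F z.2.choose := by
    rintro _ ⟨p, rfl⟩
    exact ⟨⟨π p, p, rfl⟩, key _ _ (⟨π p, p, rfl⟩ : Set.range π).2.choose_spec⟩
  exact (Set.finite_range _).subset this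

theorem exists_denom (z : K) : ∃ n : 𝓞 K, n ≠ 0 ∧ ∃ a : 𝓞 K, (a : K) = n * z := by
  obtain ⟨a, b, hb, rfl⟩ := IsFractionRing.div_surjective (A := 𝓞 K) z
  have hb0 : b ≠ 0 := nonZeroDivisors.ne_zero hb
  refine ⟨b, hb0, a, ?_⟩
  rw [mul_div_cancel₀]
  simpa using hb0

instance : IsHeckePair (intAffGroup K) where
  finite_rightCosetsIn := by
    intro g
    obtain ⟨n, hn, c, hc⟩ := exists_denom ((g.x⁻¹ : Kˣ) : K)
    obtain ⟨m, hm, d, hd⟩ := exists_denom (g.y * ((g.x⁻¹ : Kˣ) : K))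
    let F : 𝓞 K × (𝓞 K)ˣ → RightCosets (intAffGroup K) := fun p =>
      mkRightCoset _ (g * ⟨(p.1 : K), Units.map (algebraMap (𝓞 K) K).toMonoidHom p.2⟩)
    have hfin : (Set.range F).Finite := by
      refine finite_range_of_mod F (mul_ne_zero hn hm) ?_
      rintro a u b v ⟨s, hs⟩ ⟨t, ht⟩
      refine mkRightCoset_eq_iff.2 ?_
      have hs' : (b : K) - a = n * m * s := by
        have := congrArg (algebraMap (𝓞 K) K) hs
        simpa using this
      have ht' : ((v : 𝓞 K) : K) - ((u : 𝓞 K) : K) = n * m * t := by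
        have := congrArg (algebraMap (𝓞 K) K) ht
        simpa using this
      have hu : ((u : 𝓞 K) : K) ≠ 0 := by simp
      have hx : (g.x : K) ≠ 0 := g.x.ne_zero
      rw [Units.val_inv_eq_inv_val] at hc hd
      have hui : (((u⁻¹ : (𝓞 K)ˣ) : 𝓞 K) : K) = ((u : 𝓞 K) : K)⁻¹ := by
        refine eq_inv_of_mul_eq_one_left ?_
        rw [← map_mul, Units.inv_mul, map_one]
      refine ⟨⟨(c * m * s + d * n * t) * (u⁻¹ : (𝓞 K)ˣ), ?_⟩, v * u⁻¹, ?_⟩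
      · simp only [AffGroup.mul_y, AffGroup.inv_y, AffGroup.mul_x, AffGroup.inv_x, mul_inv_rev,
          Units.val_mul, map_mul, map_add, hc, hd, hui, Units.val_inv_eq_inv_val, Units.coe_map]
        simp only [RingHom.toMonoidHom_eq_coe, MonoidHom.coe_coe]
        field_simp
        linear_combination (-1 : K) * hs' - g.y * ht'
      · simp only [AffGroup.mul_x, AffGroup.inv_x, mul_inv_rev,
          Units.val_mul, map_mul, hui, Units.val_inv_eq_inv_val, Units.coe_map]
        simp only [RingHom.toMonoidHom_eq_coe, MonoidHom.coe_coe]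
        field_simp
    refine hfin.subset ?_
    rintro _ ⟨γ, hγ, rfl⟩
    obtain ⟨h, hh, k, ⟨⟨a, ha⟩, u, hu⟩, rfl⟩ := DoubleCoset.mem_doubleCoset.1 hγ
    refine ⟨(a, u), ?_⟩
    have hk : k = ⟨(a : K), Units.map (algebraMap (𝓞 K) K).toMonoidHom u⟩ :=
      AffGroup.ext ha.symm (Units.ext hu.symm)
    refine mkRightCoset_eq_iff.2 ?_
    rw [hk]
    simpa using hh

instance finite_units_quotient (r : KModO K) :
    Finite ((𝓞 K)ˣ ⧸ MulAction.stabilizer (𝓞 K)ˣ r) := by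
  have hfin : (Set.range fun u : (𝓞 K)ˣ => u • r).Finite := by
    obtain ⟨y, rfl⟩ := (intSubmodule K).mkQ_surjective r
    obtain ⟨n, hn, c, hc⟩ := exists_denom y
    have := finite_range_of_mod (fun p : 𝓞 K × (𝓞 K)ˣ => p.2 • KModO.mk y) hn (by
      rintro a u b v - ⟨t, ht⟩
      have hv : (v : 𝓞 K) = u + n * t := by rw [← ht]; ring
      show (u : 𝓞 K) • KModO.mk y = (v : 𝓞 K) • KModO.mk y
      rw [← map_smul, ← map_smul, eq_comm, KModO.mk_eq_iff]
      refine ⟨c * t, ?_⟩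
      rw [hv, Algebra.smul_def, Algebra.smul_def]
      simp only [map_add, map_mul, hc]
      ring)
    refine this.subset ?_
    rintro _ ⟨u, rfl⟩
    exact ⟨(0, u), rfl⟩
  have : Finite (MulAction.orbit (𝓞 K)ˣ r) := hfin.to_subtype
  exact Finite.of_equiv _ (MulAction.orbitEquivQuotientStabilizer (𝓞 K)ˣ r)

noncomputable instance (r : KModO K) : Fintype ((𝓞 K)ˣ ⧸ MulAction.stabilizer (𝓞 K)ˣ r) :=
  Fintype.ofFinite _

/-- `R(r)`: the number of right cosets in the double coset of `(1 r; 0 1)`, for `r ∈ K/𝓞`. -/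
noncomputable def cosetCount (r : KModO K) : ℕ :=
  Quotient.liftOn' r (fun y => numRightCosets (intAffGroup K) (transl y)) (by
    intro y z h
    exact numRightCosets_transl (Quotient.sound' h))

variable (K) in
/-- The Hecke algebra `H(P_K, P_𝓞)`. -/
abbrev HeckeK : Type u := HeckeAlgebra (intAffGroup K)

/-- `θ_r = R(r)⁻¹ [P_𝓞 (1 r; 0 1) P_𝓞]`, for `r ∈ K/𝓞`. -/
noncomputable def theta (r : KModO K) : HeckeK K :=
  Quotient.liftOn' r (fun y => (1 / (numRightCosets (intAffGroup K) (transl y) : ℂ)) •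
    HeckeAlgebra.char (intAffGroup K) (transl y)) (by
    intro y z h
    have h' : KModO.mk y = KModO.mk z := Quotient.sound' h
    simp only [numRightCosets_transl h', char_transl h'])

/-- The relations
`x_0 = 1`, `x_{wr} = x_r = x_r^*`,
`x_r x_s = R(r)⁻¹ R(s)⁻¹ ∑_{u ∈ 𝓞ˣ/𝓞ˣ_r} ∑_{v ∈ 𝓞ˣ/𝓞ˣ_s} x_{ur + vs}`
for a family `x` in a unital *-algebra, indexed by `K/𝓞`. -/
structure ThetaRelations {B : Type*} [Ring B] [StarRing B] [Algebra ℂ B] (x : KModO K → B) :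
    Prop where
  zero : x 0 = 1
  unit_smul : ∀ (w : (𝓞 K)ˣ) (r : KModO K), x (w • r) = x r
  star_eq : ∀ r : KModO K, star (x r) = x r
  mul_eq : ∀ r s : KModO K, x r * x s =
    ((1 / (cosetCount r : ℂ)) * (1 / (cosetCount s : ℂ))) •
      ∑ u : (𝓞 K)ˣ ⧸ MulAction.stabilizer (𝓞 K)ˣ r, ∑ v : (𝓞 K)ˣ ⧸ MulAction.stabilizer (𝓞 K)ˣ s,
        x (MulAction.ofQuotientStabilizer (𝓞 K)ˣ r u + MulAction.ofQuotientStabilizer (𝓞 K)ˣ s v)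

variable (K) in
/-- The *-subalgebra `𝔄` of `H(P_K, P_𝓞)` generated by the `θ_r`. -/
noncomputable def thetaAlg : StarSubalgebra ℂ (HeckeK K) :=
  StarAlgebra.adjoin ℂ (Set.range (theta (K := K)))

/-- `θ_r` as an element of `𝔄`. -/
noncomputable def thetaGen (r : KModO K) : thetaAlg K :=
  ⟨theta r, StarAlgebra.subset_adjoin ℂ _ ⟨r, rfl⟩⟩

/-- `𝔄(d)`: the linear span of the `θ_r` with `r ∈ K`, `r d ∈ 𝓞`. -/
noncomputable def thetaSpan (d : 𝓞 K) : Submodule ℂ (HeckeK K) :=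
  Submodule.span ℂ {h | ∃ r : K, (∃ a : 𝓞 K, (a : K) = r * d) ∧ h = theta (KModO.mk r)}

variable (K) in
/-- The C*-algebra `A_θ` generated by the image of `𝔄` under the Hecke representation. -/
noncomputable def thetaCStar :
    StarSubalgebra ℂ (HeckeL2 (intAffGroup K) →L[ℂ] HeckeL2 (intAffGroup K)) :=
  ((thetaAlg K).map (heckeRep (intAffGroup K))).topologicalClosure

/-- `λ(θ_r)` as an element of `A_θ`. -/
noncomputable def thetaCStarGen (r : KModO K) : thetaCStar K :=
  ⟨heckeRep (intAffGroup K) (theta r), StarSubalgebra.le_topologicalClosure _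
    ⟨theta r, (thetaGen r).2, rfl⟩⟩

/-- The unit-orbit average `R(r)⁻¹ ∑_{u ∈ 𝓞ˣ/𝓞ˣ_r} δ_{ur}` in the group algebra `ℂ[K/𝓞]`. -/
noncomputable def orbitAverage (r : KModO K) : AddMonoidAlgebra ℂ (KModO K) :=
  (1 / (cosetCount r : ℂ)) • ∑ u : (𝓞 K)ˣ ⧸ MulAction.stabilizer (𝓞 K)ˣ r,
    AddMonoidAlgebra.single (MulAction.ofQuotientStabilizer (𝓞 K)ˣ r u) 1

end NumberField

/-! ### Double cosets of translations and averages over unit orbits. -/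

section OrbitAverages

variable {K : Type u} [Field K]

/-! The algebra `𝔄` is the algebra of `𝓞ˣ`-invariants of `ℂ[K/𝓞]` in disguise. A matrix with lower
right entry in `𝓞ˣ` is a unit matrix times a translation `transl y`, so a Hecke function supported
on such matrices is determined by its restriction to translations. That restriction is a finitely
supported function on `K/𝓞`. It is invariant under `𝓞ˣ`, because conjugating a translation by a unit
matrix multiplies `y` by the unit. Convolution restricts to the product of the group algebra
(`translRestrict_mul`), and `θ_r` restricts to the average of the orbit of `r`
(`translRestrict_theta`).

Orbit averages span the invariants and have disjoint supports for distinct orbits. Hence `𝔄`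
consists of all unit-supported Hecke functions (`thetaAlg_eq_unitSupported`), it is commutative, and
the `θ_r` form a basis indexed by orbits. A family `x` satisfying the relations extends linearly to
`ℂ[K/𝓞]` by `δ_r ↦ x_r`. The product relation says exactly that this extension is multiplicative on
averages (`ThetaRelations.linComb_mul`), which gives the universal property.

The level `𝔄(d)` comes from the `d`-torsion of `K/𝓞`, which is finite, stable under units and closed
under addition. So `𝔄` is a directed union of finite-dimensional *-algebras. An injective
*-homomorphism from such an algebra into a C*-algebra has closed range, so its norm dominates that
of every other *-homomorphism into a C*-algebra (`norm_apply_le_of_injective_thetaAlg`). Therefore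
all faithful representations of `𝔄` in C*-algebras induce the same norm. Since the Hecke
representation is faithful, the universal property passes to the closure `A_θ`. Since `ℂ[K/𝓞]`
embeds in `C*(K/𝓞)`, by independence of characters, the map of `A_θ` into `C*(K/𝓞)` is isometric. -/

theorem KModO.mk_surjective : Function.Surjective (KModO.mk : K → KModO K) :=
  (intSubmodule K).mkQ_surjective

theorem KModO.unit_smul_mk (w : (𝓞 K)ˣ) (y : K) :
    w • KModO.mk y = KModO.mk (((w : 𝓞 K) : K) * y) := by
  show (w : 𝓞 K) • KModO.mk y = _
  rw [← map_smul, Algebra.smul_def]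

/-- The element of `P_𝓞` with entries `a ∈ 𝓞` and `u ∈ 𝓞ˣ`. -/
def intAff (a : 𝓞 K) (u : (𝓞 K)ˣ) : AffGroup K :=
  ⟨(a : K), Units.map (algebraMap (𝓞 K) K).toMonoidHom u⟩

theorem intAff_mem (a : 𝓞 K) (u : (𝓞 K)ˣ) : intAff a u ∈ intAffGroup K :=
  ⟨⟨a, rfl⟩, u, rfl⟩

theorem mem_intAffGroup_iff {g : AffGroup K} :
    g ∈ intAffGroup K ↔ ∃ (a : 𝓞 K) (u : (𝓞 K)ˣ), g = intAff a u := by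
  constructor
  · rintro ⟨⟨a, ha⟩, u, hu⟩
    exact ⟨a, u, AffGroup.ext ha.symm (Units.ext hu.symm)⟩
  · rintro ⟨a, u, rfl⟩
    exact intAff_mem a u

@[simp] theorem intAff_y (a : 𝓞 K) (u : (𝓞 K)ˣ) : (intAff a u).y = a := rfl
@[simp] theorem intAff_x (a : 𝓞 K) (u : (𝓞 K)ˣ) :
    (intAff a u).x = Units.map (algebraMap (𝓞 K) K).toMonoidHom u := rfl
@[simp] theorem transl_y (y : K) : (transl y).y = y := rfl
@[simp] theorem transl_x (y : K) : (transl y).x = 1 := rfl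

variable (K) in
/-- The image of `𝓞ˣ` in `Kˣ`. -/
def unitsRange : Subgroup Kˣ := (Units.map (algebraMap (𝓞 K) K).toMonoidHom).range

theorem transl_mul_transl_inv (y z : K) : transl z * (transl y)⁻¹ = transl (z - y) := by
  ext <;> simp [sub_eq_neg_add]

theorem transl_inv (y : K) : (transl y)⁻¹ = transl (-y) := by
  ext <;> simp

theorem transl_mem_iff {y : K} : transl y ∈ intAffGroup K ↔ ∃ a : 𝓞 K, (a : K) = y :=
  ⟨fun h => h.1, fun h => ⟨h, 1, by simp⟩⟩

/-- The left factor lies in `P_𝓞`, so any left-invariant function sees only the translation by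
`g.y`. -/
theorem eq_intAff_mul_transl {g : AffGroup K} {u : (𝓞 K)ˣ}
    (hu : Units.map (algebraMap (𝓞 K) K).toMonoidHom u = g.x) :
    g = intAff 0 u * transl g.y := by
  ext
  · simp
  · simp [← hu]

/-- In a product of `intAff a u`, `transl y` and `intAff b v` the upper right entry is `b + (y +
a)v`. Only the right factor moves the class of `y`, and the integral terms vanish modulo `𝓞`. -/
theorem mem_doubleCoset_transl {g : AffGroup K} {y : K} :
    g ∈ DoubleCoset.doubleCoset (transl y) (intAffGroup K : Set (AffGroup K)) (intAffGroup K) ↔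
      g.x ∈ unitsRange K ∧ KModO.mk g.y ∈ MulAction.orbit (𝓞 K)ˣ (KModO.mk y) := by
  rw [DoubleCoset.mem_doubleCoset]
  constructor
  · rintro ⟨h, hh, k, hk, rfl⟩
    obtain ⟨a, u, rfl⟩ := mem_intAffGroup_iff.1 hh
    obtain ⟨b, v, rfl⟩ := mem_intAffGroup_iff.1 hk
    refine ⟨⟨u * v, by simp⟩, v, ?_⟩
    show v • KModO.mk y = _
    rw [KModO.unit_smul_mk, eq_comm, KModO.mk_eq_iff]
    refine ⟨b + a * v, ?_⟩
    simp
    ring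
  · rintro ⟨⟨v, hv⟩, u, hu⟩
    change u • KModO.mk y = _ at hu
    rw [KModO.unit_smul_mk, eq_comm, KModO.mk_eq_iff] at hu
    obtain ⟨a, ha⟩ := hu
    -- The right factor is chosen to produce `u * y + a`; the left factor then only corrects the
    -- lower right entry from `u` to `v`.
    refine ⟨_, intAff_mem 0 (v * u⁻¹), _, intAff_mem a u, ?_⟩
    ext
    · simp [ha]
      ring
    · rw [← hv]
      simp

/-- The right coset of `(1 y; 0 1)`, as a function of the class of `y` in `K/𝓞`. -/
def cosetOf (r : KModO K) : RightCosets (intAffGroup K) :=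
  Quotient.liftOn' r (fun y => mkRightCoset _ (transl y)) (by
    intro y z h
    have h' : KModO.mk y = KModO.mk z := Quotient.sound' h
    rw [mkRightCoset_eq_iff, transl_mul_transl_inv, transl_mem_iff]
    exact KModO.mk_eq_iff.1 h'.symm)

theorem cosetOf_mk (y : K) : cosetOf (KModO.mk y) = mkRightCoset _ (transl y) := rfl

theorem cosetOf_injective : Function.Injective (cosetOf (K := K)) := by
  intro r s h
  obtain ⟨y, rfl⟩ := KModO.mk_surjective r
  obtain ⟨z, rfl⟩ := KModO.mk_surjective s
  rw [cosetOf_mk, cosetOf_mk, mkRightCoset_eq_iff, transl_mul_transl_inv, transl_mem_iff] at h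
  exact (KModO.mk_eq_iff.2 h).symm

/-- The unit part of an element of the double coset is absorbed on the left, so each of its right
cosets is represented by a translation. Counting them becomes counting the orbit. -/
theorem rightCosetsIn_transl (y : K) :
    rightCosetsIn (intAffGroup K) (transl y) =
      cosetOf '' MulAction.orbit (𝓞 K)ˣ (KModO.mk y) := by
  ext q
  constructor
  · rintro ⟨g, hg, rfl⟩
    obtain ⟨⟨u, hu⟩, ho⟩ := mem_doubleCoset_transl.1 hg
    refine ⟨_, ho, ?_⟩
    rw [cosetOf_mk, mkRightCoset_eq_iff]
    nth_rw 1 [eq_intAff_mul_transl hu]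
    simpa using intAff_mem 0 u
  · rintro ⟨r, hr, rfl⟩
    obtain ⟨z, rfl⟩ := KModO.mk_surjective r
    exact ⟨transl z, mem_doubleCoset_transl.2 ⟨one_mem _, hr⟩, rfl⟩

theorem cosetCount_eq_ncard_orbit (r : KModO K) :
    cosetCount r = (MulAction.orbit (𝓞 K)ˣ r).ncard := by
  obtain ⟨y, rfl⟩ := KModO.mk_surjective r
  show (rightCosetsIn (intAffGroup K) (transl y)).ncard = _
  rw [rightCosetsIn_transl, Set.ncard_image_of_injective _ cosetOf_injective]

theorem cosetCount_eq_of_mem_orbit {r s : KModO K} (h : s ∈ MulAction.orbit (𝓞 K)ˣ r) :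
    cosetCount s = cosetCount r := by
  rw [cosetCount_eq_ncard_orbit, cosetCount_eq_ncard_orbit, MulAction.orbit_eq_iff.2 h]

/-- The linear map on `ℂ[K/𝓞]` with `δ_r ↦ x_r`. -/
noncomputable def linComb {B : Type*} [AddCommMonoid B] [Module ℂ B] (x : KModO K → B) :
    AddMonoidAlgebra ℂ (KModO K) →ₗ[ℂ] B :=
  Finsupp.linearCombination ℂ x ∘ₗ (AddMonoidAlgebra.coeffLinearEquiv ℂ).toLinearMap

theorem linComb_single {B : Type*} [AddCommMonoid B] [Module ℂ B] (x : KModO K → B)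
    (r : KModO K) (c : ℂ) : linComb x (AddMonoidAlgebra.single r c) = c • x r := by
  show Finsupp.linearCombination ℂ x (Finsupp.single r c) = _
  simp

theorem map_linComb {B C : Type*} [AddCommMonoid B] [Module ℂ B] [AddCommMonoid C] [Module ℂ C]
    (φ : B →ₗ[ℂ] C) (x : KModO K → B) (a : AddMonoidAlgebra ℂ (KModO K)) :
    φ (linComb x a) = linComb (fun r => φ (x r)) a := by
  induction a using AddMonoidAlgebra.induction_linear with
  | zero => simp
  | add a b ha hb => rw [map_add, map_add, ha, hb, map_add]
  | single r c => rw [linComb_single, map_smul, linComb_single]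

theorem linComb_mem_span {B : Type*} [AddCommMonoid B] [Module ℂ B] (x : KModO K → B)
    (a : AddMonoidAlgebra ℂ (KModO K)) : linComb x a ∈ Submodule.span ℂ (Set.range x) := by
  induction a using AddMonoidAlgebra.induction_linear with
  | zero => simp
  | add a b ha hb => rw [map_add]; exact add_mem ha hb
  | single r c =>
    rw [linComb_single]
    exact Submodule.smul_mem _ _ (Submodule.subset_span ⟨r, rfl⟩)

variable [NumberField K]

theorem cosetCount_eq_card (r : KModO K) :
    cosetCount r = Fintype.card ((𝓞 K)ˣ ⧸ MulAction.stabilizer (𝓞 K)ˣ r) := by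
  rw [cosetCount_eq_ncard_orbit, ← Nat.card_coe_set_eq,
    Nat.card_congr (MulAction.orbitEquivQuotientStabilizer (𝓞 K)ˣ r), Nat.card_eq_fintype_card]

theorem cosetCount_ne_zero (r : KModO K) : (cosetCount r : ℂ) ≠ 0 := by
  rw [cosetCount_eq_card]
  exact_mod_cast Fintype.card_ne_zero

-- The quotient `𝓞ˣ/𝓞ˣ_r` parametrises the orbit of `r` bijectively, so at most one term is nonzero.
open Classical in
theorem sum_single_orbit (r x : KModO K) :
    ∑ u : (𝓞 K)ˣ ⧸ MulAction.stabilizer (𝓞 K)ˣ r,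
      (if MulAction.ofQuotientStabilizer (𝓞 K)ˣ r u = x then (1 : ℂ) else 0) =
      if x ∈ MulAction.orbit (𝓞 K)ˣ r then 1 else 0 := by
  split_ifs with h
  · obtain ⟨w, rfl⟩ := h
    rw [Finset.sum_eq_single (QuotientGroup.mk w)]
    · simp
    · intro u _ hu
      rw [if_neg]
      intro e
      apply hu
      exact MulAction.injective_ofQuotientStabilizer _ _ (by rw [e]; rfl)
    · simp
  · refine Finset.sum_eq_zero fun u _ => if_neg fun e => h ?_
    rw [← e]
    exact MulAction.ofQuotientStabilizer_mem_orbit _ _ _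

open Classical in
theorem coeff_orbitAverage (r x : KModO K) :
    (orbitAverage r).coeff x =
      if x ∈ MulAction.orbit (𝓞 K)ˣ r then 1 / (cosetCount r : ℂ) else 0 := by
  have := sum_single_orbit r x
  rw [orbitAverage, AddMonoidAlgebra.coeff_smul_apply, AddMonoidAlgebra.coeff_sum,
    Finsupp.finsetSum_apply]
  simp only [AddMonoidAlgebra.coeff_single, Finsupp.single_apply, this]
  simp

/-- All `R(r)` points of the orbit contribute the same value, which the factor `1 / R(r)`
normalises. -/
theorem linComb_orbitAverage {B : Type*} [AddCommGroup B] [Module ℂ B] {x : KModO K → B}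
    (hx : ∀ (w : (𝓞 K)ˣ) (r : KModO K), x (w • r) = x r) (r : KModO K) :
    linComb x (orbitAverage r) = x r := by
  have h : ∀ u : (𝓞 K)ˣ ⧸ MulAction.stabilizer (𝓞 K)ˣ r,
      x (MulAction.ofQuotientStabilizer (𝓞 K)ˣ r u) = x r := by
    intro u
    obtain ⟨w, hw⟩ := MulAction.ofQuotientStabilizer_mem_orbit (𝓞 K)ˣ r u
    rw [← hw]
    exact hx w r
  rw [orbitAverage, map_smul, map_sum]
  simp only [linComb_single, h, one_smul, Finset.sum_const, Finset.card_univ]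
  rw [← cosetCount_eq_card, ← Nat.cast_smul_eq_nsmul ℂ, smul_smul,
    one_div_mul_cancel (cosetCount_ne_zero r), one_smul]

/-- This identifies `linComb orbitAverage` with averaging of coefficients over orbits. On `δ_t` it
reduces to the symmetry of the relation "in the same orbit" and the constancy of `R` on orbits. -/
theorem coeff_linComb_orbitAverage (a : AddMonoidAlgebra ℂ (KModO K)) (x : KModO K) :
    (linComb orbitAverage a).coeff x = (1 / (cosetCount x : ℂ)) *
      ∑ u : (𝓞 K)ˣ ⧸ MulAction.stabilizer (𝓞 K)ˣ x,
        a.coeff (MulAction.ofQuotientStabilizer (𝓞 K)ˣ x u) := by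
  classical
  induction a using AddMonoidAlgebra.induction_linear with
  | zero => simp
  | add a b ha hb =>
    rw [map_add, AddMonoidAlgebra.coeff_add, Finsupp.add_apply, ha, hb, ← mul_add,
      ← Finset.sum_add_distrib]
    rfl
  | single t c =>
    have e : ∀ s : KModO K, (AddMonoidAlgebra.single t c).coeff s
        = c * (if s = t then (1 : ℂ) else 0) := by
      intro s
      rw [AddMonoidAlgebra.coeff_single, Finsupp.single_apply]
      simp [eq_comm]
    simp only [e, ← Finset.mul_sum, sum_single_orbit]
    rw [linComb_single, AddMonoidAlgebra.coeff_smul_apply, coeff_orbitAverage, smul_eq_mul]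
    by_cases h : x ∈ MulAction.orbit (𝓞 K)ˣ t
    · rw [if_pos h, if_pos (MulAction.mem_orbit_symm.1 h), cosetCount_eq_of_mem_orbit h]
      ring
    · rw [if_neg h, if_neg fun h' => h (MulAction.mem_orbit_symm.1 h')]
      ring

theorem linComb_orbitAverage_of_invariant {a : AddMonoidAlgebra ℂ (KModO K)}
    (ha : ∀ (w : (𝓞 K)ˣ) (r : KModO K), a.coeff (w • r) = a.coeff r) :
    linComb orbitAverage a = a := by
  ext x
  have h : ∀ u : (𝓞 K)ˣ ⧸ MulAction.stabilizer (𝓞 K)ˣ x,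
      a.coeff (MulAction.ofQuotientStabilizer (𝓞 K)ˣ x u) = a.coeff x := by
    intro u
    obtain ⟨w, hw⟩ := MulAction.ofQuotientStabilizer_mem_orbit (𝓞 K)ˣ x u
    rw [← hw]
    exact ha w x
  rw [coeff_linComb_orbitAverage]
  simp only [h, Finset.sum_const, Finset.card_univ, nsmul_eq_mul]
  rw [← cosetCount_eq_card, ← mul_assoc, one_div_mul_cancel (cosetCount_ne_zero x), one_mul]

end OrbitAverages

/-! ### Restriction to translations, and `𝔄` as the unit-supported Hecke functions. -/

section Restriction

variable {K : Type u} [Field K] [NumberField K]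

/-- Restriction of a Hecke function to the translations `(1 y; 0 1)`, as a function of
`y ∈ K/𝓞`. -/
noncomputable def translRestrict : HeckeK K →ₗ[ℂ] AddMonoidAlgebra ℂ (KModO K) where
  toFun f := .ofCoeff (Finsupp.ofSupportFinite (fun r => f (cosetOf r).out)
    (f.isHeckeFun.finite.preimage cosetOf_injective.injOn))
  map_add' f f' := AddMonoidAlgebra.ext (Finsupp.ext fun r => by
    rw [AddMonoidAlgebra.coeff_add, Finsupp.add_apply]
    rfl)
  map_smul' c f := AddMonoidAlgebra.ext (Finsupp.ext fun r => by
    rw [RingHom.id_apply, AddMonoidAlgebra.coeff_smul_apply]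
    rfl)

theorem coeff_translRestrict_mk (f : HeckeK K) (y : K) :
    (translRestrict f).coeff (KModO.mk y) = f (transl y) :=
  out_mkRightCoset f.isHeckeFun.left_inv _

/-- By bi-invariance, since `intAff 0 w⁻¹ * transl y * intAff 0 w` is the translation by `w * y`. -/
theorem coeff_translRestrict_smul (f : HeckeK K) (w : (𝓞 K)ˣ) (r : KModO K) :
    (translRestrict f).coeff (w • r) = (translRestrict f).coeff r := by
  obtain ⟨y, rfl⟩ := KModO.mk_surjective r
  rw [KModO.unit_smul_mk, coeff_translRestrict_mk, coeff_translRestrict_mk,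
    ← f.isHeckeFun.left_inv _ (intAff_mem 0 w⁻¹) (transl y),
    ← f.isHeckeFun.right_inv _ (intAff_mem 0 w) (intAff 0 w⁻¹ * transl y)]
  exact congrArg f.1 (AffGroup.ext (by simp [mul_comm]) (by simp))

theorem translRestrict_star (f : HeckeK K) : translRestrict (star f) = star (translRestrict f) := by
  ext r
  obtain ⟨y, rfl⟩ := KModO.mk_surjective r
  rw [GroupAlg.coeff_star, ← map_neg, coeff_translRestrict_mk, coeff_translRestrict_mk,
    HeckeAlgebra.star_apply, transl_inv]

theorem translRestrict_one : translRestrict (1 : HeckeK K) = 1 := by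
  classical
  ext r
  obtain ⟨y, rfl⟩ := KModO.mk_surjective r
  rw [coeff_translRestrict_mk, AddMonoidAlgebra.one_def, AddMonoidAlgebra.coeff_single,
    Finsupp.single_apply]
  refine (HeckeAlgebra.char_one_apply _).trans (if_congr ?_ rfl rfl)
  rw [transl_mem_iff, ← map_zero (intSubmodule K).mkQ, eq_comm, KModO.mk_eq_iff, sub_zero]

theorem translRestrict_theta (r : KModO K) : translRestrict (theta r) = orbitAverage r := by
  classical
  ext x
  obtain ⟨y, rfl⟩ := KModO.mk_surjective r
  obtain ⟨z, rfl⟩ := KModO.mk_surjective x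
  rw [coeff_translRestrict_mk, coeff_orbitAverage]
  show (1 / (cosetCount (KModO.mk y) : ℂ)) *
    (if transl z ∈ DoubleCoset.doubleCoset (transl y) (intAffGroup K : Set (AffGroup K))
      (intAffGroup K) then 1 else 0) = _
  rw [if_congr (mem_doubleCoset_transl.trans (and_iff_right (one_mem _))) rfl rfl, mul_ite,
    mul_one, mul_zero, transl_y]

variable (K) in
/-- The *-subalgebra of Hecke functions supported on matrices with determinant in `𝓞ˣ`. -/
noncomputable def unitSupported : StarSubalgebra ℂ (HeckeK K) where
  carrier := {f | ∀ g, f g ≠ 0 → g.x ∈ unitsRange K}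
  mul_mem' := by
    intro f f' hf hf' g hg
    obtain ⟨q, hq⟩ := not_forall.1 (mt finsum_eq_zero_of_forall_eq_zero hg)
    have := mul_mem (hf _ (left_ne_zero_of_mul hq)) (hf' _ (right_ne_zero_of_mul hq))
    simpa using this
  add_mem' := by
    intro f f' hf hf' g hg
    by_cases h : f g = 0
    · exact hf' g (by simpa [h] using hg)
    · exact hf g h
  algebraMap_mem' := by
    classical
    intro c g hg
    rw [Algebra.algebraMap_eq_smul_one] at hg
    have h1 : HeckeAlgebra.char (intAffGroup K) 1 g ≠ 0 := right_ne_zero_of_mul hg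
    rw [HeckeAlgebra.char_one_apply] at h1
    obtain ⟨a, u, rfl⟩ := mem_intAffGroup_iff.1 (by_contra fun h => h1 (if_neg h))
    exact ⟨u, rfl⟩
  star_mem' := by
    intro f hf g hg
    have := hf g⁻¹ (by simpa [HeckeAlgebra.star_apply] using hg)
    simpa using this

theorem theta_mem_unitSupported (r : KModO K) : theta r ∈ unitSupported K := by
  classical
  intro g hg
  obtain ⟨y, rfl⟩ := KModO.mk_surjective r
  have h : (if g ∈ DoubleCoset.doubleCoset (transl y) (intAffGroup K : Set (AffGroup K))
      (intAffGroup K) then (1 : ℂ) else 0) ≠ 0 := right_ne_zero_of_mul hg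
  exact (mem_doubleCoset_transl.1 (by_contra fun h' => h (if_neg h'))).1

theorem translRestrict_injOn : Set.InjOn (translRestrict (K := K)) (unitSupported K) := by
  intro f hf f' hf' h
  have key : ∀ f : HeckeK K, f ∈ unitSupported K → translRestrict f = 0 → f = 0 := by
    intro f hf h
    refine HeckeAlgebra.ext fun g => by_contra fun hg => hg ?_
    obtain ⟨u, hu⟩ := hf g hg
    rw [eq_intAff_mul_transl hu, f.isHeckeFun.left_inv _ (intAff_mem 0 u),
      ← coeff_translRestrict_mk, h]
    rfl
  exact sub_eq_zero.1 (key _ (sub_mem hf hf') (by rw [map_sub, h, sub_self]))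

/-- The convolution runs over all right cosets, but the right factor kills those not represented by
a translation. On the remaining ones `transl y * (transl z)⁻¹` is `transl (y - z)`, which gives
convolution on `K/𝓞`. Nothing is needed of the support of `f`. -/
theorem translRestrict_mul (f : HeckeK K) {f' : HeckeK K} (hf' : f' ∈ unitSupported K) :
    translRestrict (f * f') = translRestrict f * translRestrict f' := by
  ext r
  obtain ⟨y, rfl⟩ := KModO.mk_surjective r
  rw [coeff_translRestrict_mk, AddMonoidAlgebra.coeff_mul_apply_right, Finsupp.sum,
    HeckeAlgebra.mul_apply, heckeConv]
  have hs : ∀ s : KModO K, f (transl y * (cosetOf s).out⁻¹) * f' (cosetOf s).out =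
      (translRestrict f).coeff (KModO.mk y + -s) * (translRestrict f').coeff s := by
    intro s
    obtain ⟨z, rfl⟩ := KModO.mk_surjective s
    rw [← map_neg, ← map_add, coeff_translRestrict_mk, coeff_translRestrict_mk, ← sub_eq_add_neg,
      ← transl_mul_transl_inv]
    exact out_mkRightCoset (F := fun g => f (transl y * g⁻¹) * f' g)
      (heckeConv_summand_inv f.isHeckeFun.right_inv f'.isHeckeFun.left_inv _) _
  -- A representative at which `f'` is nonzero has a unit as its lower right entry, so it is a
  -- translation modulo `P_𝓞` on the left.
  have hr : ∀ q : RightCosets (intAffGroup K),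
      f (transl y * q.out⁻¹) * f' q.out ≠ 0 → ∃ s, cosetOf s = q := by
    intro q hq
    obtain ⟨u, hu⟩ := hf' _ (right_ne_zero_of_mul hq)
    refine ⟨KModO.mk q.out.y, ?_⟩
    rw [cosetOf_mk, ← Quotient.out_eq q]
    refine mkRightCoset_eq_iff.2 ?_
    rw [Quotient.out_eq]
    nth_rw 1 [eq_intAff_mul_transl hu]
    simpa using intAff_mem 0 u
  rw [finsum_eq_sum_of_support_subset (s := (translRestrict f').coeff.support.map
    ⟨cosetOf, cosetOf_injective⟩), Finset.sum_map]
  · exact Finset.sum_congr rfl fun s _ => hs s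
  · intro q hq
    obtain ⟨s, rfl⟩ := hr q hq
    simp only [Finset.coe_map, Function.Embedding.coeFn_mk]
    exact ⟨s, Finsupp.mem_support_iff.2 (right_ne_zero_of_mul
      (a := f (transl y * (cosetOf s).out⁻¹)) (b := f' (cosetOf s).out) hq), rfl⟩

theorem translRestrict_linComb_theta (a : AddMonoidAlgebra ℂ (KModO K)) :
    translRestrict (linComb theta a) = linComb orbitAverage a := by
  rw [map_linComb]
  simp only [translRestrict_theta]

theorem span_theta_le_unitSupported :
    Submodule.span ℂ (Set.range (theta (K := K))) ≤
      (unitSupported K).toSubalgebra.toSubmodule := by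
  refine Submodule.span_le.2 ?_
  rintro _ ⟨r, rfl⟩
  exact theta_mem_unitSupported r

/-- Both sides are unit-supported, and after restriction the claim is that averaging fixes invariant
elements. -/
theorem linComb_theta_translRestrict {f : HeckeK K} (hf : f ∈ unitSupported K) :
    linComb theta (translRestrict f) = f := by
  refine translRestrict_injOn (span_theta_le_unitSupported (linComb_mem_span theta _)) hf ?_
  rw [translRestrict_linComb_theta,
    linComb_orbitAverage_of_invariant (coeff_translRestrict_smul f)]

theorem thetaAlg_eq_unitSupported : thetaAlg K = unitSupported K := by
  refine le_antisymm (StarAlgebra.adjoin_le ?_) fun f hf => ?_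
  · rintro _ ⟨r, rfl⟩
    exact theta_mem_unitSupported r
  · rw [← linComb_theta_translRestrict hf]
    have : Submodule.span ℂ (Set.range (theta (K := K))) ≤
        (thetaAlg K).toSubalgebra.toSubmodule :=
      Submodule.span_le.2 (StarAlgebra.subset_adjoin ℂ _)
    exact this (linComb_mem_span theta _)

theorem theta_smul (w : (𝓞 K)ˣ) (r : KModO K) : theta (w • r) = theta r := by
  refine translRestrict_injOn (theta_mem_unitSupported _) (theta_mem_unitSupported _) ?_
  classical
  rw [translRestrict_theta, translRestrict_theta]
  ext x
  rw [coeff_orbitAverage, coeff_orbitAverage, MulAction.orbit_smul,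
    cosetCount_eq_of_mem_orbit (MulAction.mem_orbit r w)]

theorem linComb_mul_orbitAverage {B : Type*} [AddCommGroup B] [Module ℂ B] (x : KModO K → B)
    (r s : KModO K) : linComb x (orbitAverage r * orbitAverage s) =
      ((1 / (cosetCount r : ℂ)) * (1 / (cosetCount s : ℂ))) •
      ∑ u : (𝓞 K)ˣ ⧸ MulAction.stabilizer (𝓞 K)ˣ r, ∑ v : (𝓞 K)ˣ ⧸ MulAction.stabilizer (𝓞 K)ˣ s,
        x (MulAction.ofQuotientStabilizer (𝓞 K)ˣ r u +
          MulAction.ofQuotientStabilizer (𝓞 K)ˣ s v) := by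
  rw [orbitAverage, orbitAverage, smul_mul_smul_comm, map_smul, Finset.sum_mul_sum]
  simp only [map_sum, AddMonoidAlgebra.single_mul_single, linComb_single, mul_one, one_smul]

/-- Each relation is checked in `ℂ[K/𝓞]`, where restriction is injective on unit-supported
functions. For the product, `θ_r θ_s` is recovered from its restriction, the product of two orbit
averages. -/
theorem thetaRelations_theta : ThetaRelations (theta (K := K)) where
  zero := by
    refine translRestrict_injOn (theta_mem_unitSupported _) (one_mem _) ?_
    rw [translRestrict_theta, translRestrict_one]
    classical
    ext x
    rw [coeff_orbitAverage, AddMonoidAlgebra.one_def, AddMonoidAlgebra.coeff_single,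
      Finsupp.single_apply]
    have h0 : MulAction.orbit (𝓞 K)ˣ (0 : KModO K) = {0} := by
      ext y
      simp [MulAction.mem_orbit_iff, eq_comm]
    rw [cosetCount_eq_ncard_orbit, h0, Set.ncard_singleton]
    simp [eq_comm]
  unit_smul := theta_smul
  star_eq r := by
    refine translRestrict_injOn (star_mem (theta_mem_unitSupported _))
      (theta_mem_unitSupported _) ?_
    rw [translRestrict_star]
    ext x
    -- Self-adjointness rests on `-1` being a unit: the orbit of `r` contains `-r`.
    rw [GroupAlg.coeff_star, show -x = (-1 : (𝓞 K)ˣ) • x by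
      rw [Units.smul_def]; simp, coeff_translRestrict_smul, translRestrict_theta]
    classical
    rw [coeff_orbitAverage]
    split_ifs <;> simp
  mul_eq r s := by
    rw [← linComb_mul_orbitAverage, ← translRestrict_theta, ← translRestrict_theta,
      ← translRestrict_mul _ (theta_mem_unitSupported _), linComb_theta_translRestrict]
    exact mul_mem (theta_mem_unitSupported _) (theta_mem_unitSupported _)

end Restriction

/-! ### The relations, the universal property of `𝔄`, and its basis. -/

section Relations

variable {K : Type u} [Field K] [NumberField K]
variable {B : Type*} [Ring B] [StarRing B] [Algebra ℂ B]
variable {C : Type*} [Ring C] [StarRing C] [Algebra ℂ C]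

theorem ThetaRelations.map {x : KModO K → B} (hx : ThetaRelations x) (φ : B →⋆ₐ[ℂ] C) :
    ThetaRelations fun r => φ (x r) where
  zero := by rw [hx.zero, map_one]
  unit_smul w r := by rw [hx.unit_smul]
  star_eq r := by rw [← map_star, hx.star_eq]
  mul_eq r s := by
    rw [← map_mul, hx.mul_eq, map_smul]
    simp only [map_sum]

theorem ThetaRelations.of_injective {x : KModO K → B} (φ : B →⋆ₐ[ℂ] C)
    (hφ : Function.Injective φ) (hx : ThetaRelations fun r => φ (x r)) : ThetaRelations x where
  zero := hφ (by rw [hx.zero, map_one])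
  unit_smul w r := hφ (hx.unit_smul w r)
  star_eq r := hφ (by rw [map_star, hx.star_eq])
  mul_eq r s := hφ (by
    rw [map_mul, hx.mul_eq, map_smul]
    simp only [map_sum])

theorem ThetaRelations.neg {x : KModO K → B} (hx : ThetaRelations x) (r : KModO K) :
    x (-r) = x r := by
  rw [← hx.unit_smul (-1) r, Units.smul_def]
  simp

/-- Both sides are bilinear in `a` and `b`, and on basis elements this is the product relation.
Multiplicativity is claimed only for averages, not on all of `ℂ[K/𝓞]`. -/
theorem ThetaRelations.linComb_mul {x : KModO K → B} (hx : ThetaRelations x)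
    (a b : AddMonoidAlgebra ℂ (KModO K)) :
    linComb x (linComb orbitAverage a * linComb orbitAverage b) = linComb x a * linComb x b := by
  induction a using AddMonoidAlgebra.induction_linear with
  | zero => simp
  | add a a' h h' => simp only [map_add, add_mul, h, h']
  | single r c =>
    induction b using AddMonoidAlgebra.induction_linear with
    | zero => simp
    | add b b' h h' => simp only [map_add, mul_add, h, h']
    | single s d =>
      simp only [linComb_single, smul_mul_smul_comm]
      rw [map_smul, linComb_mul_orbitAverage, ← hx.mul_eq]

theorem ThetaRelations.linComb_star [StarModule ℂ B] {x : KModO K → B} (hx : ThetaRelations x)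
    (a : AddMonoidAlgebra ℂ (KModO K)) : linComb x (star a) = star (linComb x a) := by
  induction a using AddMonoidAlgebra.induction_linear with
  | zero => simp
  | add a a' h h' => simp only [map_add, star_add, h, h']
  | single r c =>
    rw [GroupAlg.star_single, linComb_single, linComb_single, hx.neg, star_smul, hx.star_eq,
      starRingEnd_apply]

theorem ThetaRelations.linComb_average {x : KModO K → B} (hx : ThetaRelations x)
    (a : AddMonoidAlgebra ℂ (KModO K)) : linComb x (linComb orbitAverage a) = linComb x a := by
  rw [map_linComb]
  simp only [linComb_orbitAverage hx.unit_smul]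

theorem mem_unitSupported_of_thetaAlg (f : thetaAlg K) : (f : HeckeK K) ∈ unitSupported K := by
  rw [← thetaAlg_eq_unitSupported]
  exact f.2

theorem linComb_average_translRestrict (f : HeckeK K) :
    linComb orbitAverage (translRestrict f) = translRestrict f :=
  linComb_orbitAverage_of_invariant (coeff_translRestrict_smul f)

/-- The *-homomorphism `𝔄 → B` defined by a family satisfying the relations. -/
noncomputable def thetaLift [StarModule ℂ B] {x : KModO K → B} (hx : ThetaRelations x) :
    thetaAlg K →⋆ₐ[ℂ] B where
  toFun f := linComb x (translRestrict (f : HeckeK K))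
  map_zero' := by simp
  map_one' := by
    rw [OneMemClass.coe_one, translRestrict_one, AddMonoidAlgebra.one_def, linComb_single,
      one_smul, hx.zero]
  map_add' f g := by simp
  map_mul' f g := by
    -- Restrictions are invariant, so each is replaced by its own average, the form in which
    -- `linComb x` is multiplicative.
    rw [MulMemClass.coe_mul, translRestrict_mul _ (mem_unitSupported_of_thetaAlg g),
      ← linComb_average_translRestrict f.1, ← linComb_average_translRestrict g.1, hx.linComb_mul,
      hx.linComb_average, hx.linComb_average]
  commutes' c := by
    rw [Algebra.algebraMap_eq_smul_one, Algebra.algebraMap_eq_smul_one, SetLike.val_smul,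
      map_smul, map_smul, OneMemClass.coe_one, translRestrict_one, AddMonoidAlgebra.one_def,
      linComb_single, one_smul, hx.zero]
  map_star' f := by
    rw [StarMemClass.coe_star, translRestrict_star, hx.linComb_star]

theorem thetaLift_thetaGen [StarModule ℂ B] {x : KModO K → B} (hx : ThetaRelations x)
    (r : KModO K) : thetaLift hx (thetaGen r) = x r := by
  show linComb x (translRestrict (theta r)) = x r
  rw [translRestrict_theta, linComb_orbitAverage hx.unit_smul]

theorem thetaRelations_thetaGen : ThetaRelations (thetaGen (K := K)) :=
  ThetaRelations.of_injective (thetaAlg K).subtype Subtype.val_injective thetaRelations_theta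

theorem linComb_thetaGen (f : thetaAlg K) :
    linComb thetaGen (translRestrict (f : HeckeK K)) = f := by
  refine Subtype.ext ?_
  have h := map_linComb (thetaAlg K).toSubalgebra.val.toLinearMap thetaGen
    (translRestrict (f : HeckeK K))
  exact h.trans (linComb_theta_translRestrict (mem_unitSupported_of_thetaAlg f))

/-- The generators already span `𝔄` linearly, by `linComb_thetaGen`. -/
theorem thetaAlg_hom_ext {φ ψ : thetaAlg K →⋆ₐ[ℂ] B}
    (h : ∀ r, φ (thetaGen r) = ψ (thetaGen r)) : φ = ψ := by
  refine StarAlgHom.ext fun f => ?_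
  rw [← linComb_thetaGen f]
  have h1 := map_linComb φ.toAlgHom.toLinearMap thetaGen (translRestrict (f : HeckeK K))
  have h2 := map_linComb ψ.toAlgHom.toLinearMap thetaGen (translRestrict (f : HeckeK K))
  refine h1.trans (Eq.trans ?_ h2.symm)
  congr 2
  exact funext h

theorem thetaAlg_mul_comm (f g : thetaAlg K) : f * g = g * f := by
  refine Subtype.ext (translRestrict_injOn (mem_unitSupported_of_thetaAlg _)
    (mem_unitSupported_of_thetaAlg _) ?_)
  rw [MulMemClass.coe_mul, MulMemClass.coe_mul,
    translRestrict_mul _ (mem_unitSupported_of_thetaAlg g),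
    translRestrict_mul _ (mem_unitSupported_of_thetaAlg f), mul_comm]

/-- Restriction is a *-homomorphism on `𝔄` sending `θ_r` to the orbit average, so the relations are
transported from the `θ_r`. -/
theorem thetaRelations_orbitAverage : ThetaRelations (orbitAverage (K := K)) := by
  let φ : thetaAlg K →⋆ₐ[ℂ] AddMonoidAlgebra ℂ (KModO K) :=
    { toFun := fun f => translRestrict (f : HeckeK K)
      map_zero' := by simp
      map_one' := translRestrict_one
      map_add' := by simp
      map_mul' := fun f g => translRestrict_mul _ (mem_unitSupported_of_thetaAlg g)
      commutes' := fun c => by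
        rw [Algebra.algebraMap_eq_smul_one, Algebra.algebraMap_eq_smul_one, SetLike.val_smul,
          map_smul, OneMemClass.coe_one, translRestrict_one]
      map_star' := fun f => translRestrict_star _ }
  have h := thetaRelations_thetaGen.map φ
  have e : (fun r => φ (thetaGen r)) = orbitAverage (K := K) := funext translRestrict_theta
  rwa [e] at h

theorem thetaLift_orbitAverage_apply (f : thetaAlg K) :
    thetaLift (thetaRelations_orbitAverage (K := K)) f = translRestrict (f : HeckeK K) :=
  linComb_average_translRestrict _

theorem thetaLift_orbitAverage_injective :
    Function.Injective (thetaLift (thetaRelations_orbitAverage (K := K))) := by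
  intro f g h
  rw [thetaLift_orbitAverage_apply, thetaLift_orbitAverage_apply] at h
  exact Subtype.ext (translRestrict_injOn (mem_unitSupported_of_thetaAlg _)
    (mem_unitSupported_of_thetaAlg _) h)

variable (K) in
theorem exists_basis_thetaGen :
    ∃ b : Module.Basis (MulAction.orbitRel.Quotient (𝓞 K)ˣ (KModO K)) ℂ (thetaAlg K),
      ∀ r : KModO K, b (Quotient.mk'' r) = thetaGen r := by
  classical
  let v : MulAction.orbitRel.Quotient (𝓞 K)ˣ (KModO K) → thetaAlg K := fun q =>
    Quotient.liftOn' q thetaGen (by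
      rintro _ r ⟨w, rfl⟩
      exact thetaRelations_thetaGen.unit_smul w r)
  have hv : ∀ r : KModO K, v (Quotient.mk'' r) = thetaGen r := fun r => rfl
  have hli : LinearIndependent ℂ v := by
    -- Independence is tested in `ℂ[K/𝓞]`: the coefficient at a point `x` isolates the one average
    -- supported on the orbit of `x`.
    refine LinearIndependent.of_comp
      (thetaLift (thetaRelations_orbitAverage (K := K))).toAlgHom.toLinearMap (linearIndependent_iff'.2 fun s c hc q hq => ?_)
    obtain ⟨x, rfl⟩ := Quotient.mk''_surjective q
    have hval : ∀ p : MulAction.orbitRel.Quotient (𝓞 K)ˣ (KModO K),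
        (thetaLift (thetaRelations_orbitAverage (K := K)) (v p)).coeff x =
          if p = Quotient.mk'' x then 1 / (cosetCount x : ℂ) else 0 := by
      intro p
      obtain ⟨r, rfl⟩ := Quotient.mk''_surjective p
      rw [hv, thetaLift_thetaGen, coeff_orbitAverage]
      by_cases h : x ∈ MulAction.orbit (𝓞 K)ˣ r
      · rw [if_pos h, if_pos (Quotient.sound' (MulAction.mem_orbit_symm.1 h)),
          cosetCount_eq_of_mem_orbit h]
      · rw [if_neg h, if_neg fun e => h (MulAction.mem_orbit_symm.1 (Quotient.exact' e))]
    have h := congrArg (fun a : AddMonoidAlgebra ℂ (KModO K) => a.coeff x) hc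
    have h' : ∑ p ∈ s, c p * (thetaLift (thetaRelations_orbitAverage (K := K)) (v p)).coeff x = 0 := by
      simpa [AddMonoidAlgebra.coeff_sum, Finsupp.finsetSum_apply] using h
    simp only [hval, mul_ite, mul_zero, Finset.sum_ite_eq', if_pos hq] at h'
    exact (mul_eq_zero.1 h').resolve_right (one_div_ne_zero (cosetCount_ne_zero x))
  refine ⟨Module.Basis.mk hli fun f _ => ?_, fun r => by rw [Module.Basis.mk_apply, hv]⟩
  rw [← linComb_thetaGen f]
  refine Submodule.span_mono ?_ (linComb_mem_span thetaGen _)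
  rintro _ ⟨r, rfl⟩
  exact ⟨Quotient.mk'' r, hv r⟩

end Relations

/-! ### The finite-dimensional levels `𝔄(d)` and torsion in `K/𝓞`. -/

section Levels

variable {K : Type u} [Field K]

theorem KModO.smul_mk_eq_zero_iff {d : 𝓞 K} {y : K} :
    d • KModO.mk y = 0 ↔ ∃ a : 𝓞 K, (a : K) = y * d := by
  rw [← map_smul, ← map_zero (intSubmodule K).mkQ, KModO.mk_eq_iff, sub_zero, Algebra.smul_def,
    mul_comm]

theorem smul_ofQuotientStabilizer_eq_zero {d : 𝓞 K} {r : KModO K} (hr : d • r = 0)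
    (u : (𝓞 K)ˣ ⧸ MulAction.stabilizer (𝓞 K)ˣ r) :
    d • MulAction.ofQuotientStabilizer (𝓞 K)ˣ r u = 0 := by
  obtain ⟨w, hw⟩ := MulAction.ofQuotientStabilizer_mem_orbit (𝓞 K)ˣ r u
  rw [← hw]
  show d • w • r = 0
  rw [smul_comm, hr, smul_zero]

variable [NumberField K]

/-- The condition `rd ∈ 𝓞` says that `d` annihilates the class of `r`, so the level is indexed by an
`𝓞`-submodule of `K/𝓞`. -/
theorem thetaSpan_eq (d : 𝓞 K) :
    thetaSpan d = Submodule.span ℂ (theta '' {r : KModO K | d • r = 0}) := by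
  unfold thetaSpan
  congr 1
  ext h
  constructor
  · rintro ⟨y, hy, rfl⟩
    exact ⟨_, KModO.smul_mk_eq_zero_iff.2 hy, rfl⟩
  · rintro ⟨r, hr, rfl⟩
    obtain ⟨y, rfl⟩ := KModO.mk_surjective r
    exact ⟨y, KModO.smul_mk_eq_zero_iff.1 hr, rfl⟩

theorem theta_mem_thetaSpan {d : 𝓞 K} {r : KModO K} (h : d • r = 0) : theta r ∈ thetaSpan d := by
  rw [thetaSpan_eq]
  exact Submodule.subset_span ⟨r, h, rfl⟩

theorem finite_torsion {d : 𝓞 K} (hd : d ≠ 0) : {r : KModO K | d • r = 0}.Finite := by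
  have hd' : (d : K) ≠ 0 := by simpa using hd
  -- The torsion classes are those of `a / d`, which depend only on `a` modulo `d`; the unit
  -- coordinate is a dummy.
  refine (finite_range_of_mod (fun p : 𝓞 K × (𝓞 K)ˣ => KModO.mk ((p.1 : K) / d)) hd ?_).subset ?_
  · rintro a u b v ⟨t, ht⟩ -
    rw [eq_comm, KModO.mk_eq_iff]
    refine ⟨t, ?_⟩
    rw [← sub_div, ← map_sub, ht, map_mul, mul_div_cancel_left₀ _ hd']
  · intro r hr
    obtain ⟨y, rfl⟩ := KModO.mk_surjective r
    obtain ⟨a, ha⟩ := KModO.smul_mk_eq_zero_iff.1 hr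
    exact ⟨(a, 1), by simp only [ha, mul_div_cancel_right₀ _ hd']⟩

theorem finiteDimensional_thetaSpan {d : 𝓞 K} (hd : d ≠ 0) :
    FiniteDimensional ℂ (thetaSpan d) := by
  rw [thetaSpan_eq]
  exact FiniteDimensional.span_of_finite ℂ ((finite_torsion hd).image _)

/-- `𝔄(d)` as a *-subalgebra. -/
noncomputable def thetaSpanAlg (d : 𝓞 K) : StarSubalgebra ℂ (HeckeK K) where
  carrier := thetaSpan d
  add_mem' := add_mem
  mul_mem' := by
    intro f g hf hg
    have h : thetaSpan d * thetaSpan d ≤ thetaSpan d := by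
      conv_lhs => rw [thetaSpan_eq, Submodule.span_mul_span]
      refine Submodule.span_le.2 ?_
      rintro _ ⟨_, ⟨r, hr, rfl⟩, _, ⟨s, hs, rfl⟩, rfl⟩
      show theta r * theta s ∈ thetaSpan d
      rw [thetaRelations_theta.mul_eq]
      refine Submodule.smul_mem _ _ (sum_mem fun u _ => sum_mem fun v _ => theta_mem_thetaSpan ?_)
      rw [smul_add, smul_ofQuotientStabilizer_eq_zero hr, smul_ofQuotientStabilizer_eq_zero hs,
        add_zero]
    exact h (Submodule.mul_mem_mul hf hg)
  algebraMap_mem' c := by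
    rw [Algebra.algebraMap_eq_smul_one, ← thetaRelations_theta.zero]
    exact Submodule.smul_mem _ _ (theta_mem_thetaSpan (smul_zero d))
  star_mem' := by
    intro f hf
    have h : ∀ f ∈ Submodule.span ℂ (theta '' {r : KModO K | d • r = 0}),
        star f ∈ thetaSpan d := by
      intro f hf
      induction hf using Submodule.span_induction with
      | mem f hf =>
        obtain ⟨r, hr, rfl⟩ := hf
        rw [thetaRelations_theta.star_eq]
        exact theta_mem_thetaSpan hr
      | zero => rw [star_zero]; exact zero_mem _
      | add f g _ _ hf hg => rw [star_add]; exact add_mem hf hg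
      | smul c f _ hf => rw [star_smul]; exact Submodule.smul_mem _ _ hf
    rw [← thetaSpan_eq] at h
    exact h f hf

theorem thetaSpanAlg_toSubmodule (d : 𝓞 K) :
    (thetaSpanAlg d).toSubalgebra.toSubmodule = thetaSpan d :=
  Submodule.ext fun _ => Iff.rfl

theorem thetaSpanAlg_le_thetaAlg (d : 𝓞 K) : thetaSpanAlg d ≤ thetaAlg K := by
  have h : thetaSpan d ≤ (thetaAlg K).toSubalgebra.toSubmodule := by
    rw [thetaSpan_eq]
    refine Submodule.span_le.2 ?_
    rintro _ ⟨r, -, rfl⟩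
    exact (thetaGen r).2
  exact h

/-- This makes the family of levels directed: two levels `d` and `e` both lie in level `d * e`. -/
theorem thetaSpan_le_mul_right (d e : 𝓞 K) : thetaSpan d ≤ thetaSpan (d * e) := by
  rw [thetaSpan_eq]
  refine Submodule.span_le.2 ?_
  rintro _ ⟨r, hr, rfl⟩
  exact theta_mem_thetaSpan (by rw [mul_comm, mul_smul, show d • r = 0 from hr, smul_zero])

theorem exists_mem_thetaSpan (f : thetaAlg K) : ∃ d : 𝓞 K, d ≠ 0 ∧ (f : HeckeK K) ∈ thetaSpan d := by
  rw [← linComb_theta_translRestrict (mem_unitSupported_of_thetaAlg f)]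
  -- The claim is generalised from the restriction of `f` to an arbitrary element of `ℂ[K/𝓞]`, since
  -- induction on basis elements leaves the invariants.
  induction translRestrict (f : HeckeK K) using AddMonoidAlgebra.induction_linear with
  | zero => exact ⟨1, one_ne_zero, by simp⟩
  | add a b ha hb =>
    obtain ⟨d, hd, hda⟩ := ha
    obtain ⟨e, he, heb⟩ := hb
    refine ⟨d * e, mul_ne_zero hd he, ?_⟩
    rw [map_add]
    refine add_mem (thetaSpan_le_mul_right d e hda) ?_
    rw [mul_comm]
    exact thetaSpan_le_mul_right e d heb
  | single r c =>
    obtain ⟨y, rfl⟩ := KModO.mk_surjective r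
    obtain ⟨n, hn, a, ha⟩ := exists_denom y
    refine ⟨n, hn, ?_⟩
    rw [linComb_single]
    exact Submodule.smul_mem _ _ (theta_mem_thetaSpan
      (KModO.smul_mk_eq_zero_iff.2 ⟨a, by rw [ha, mul_comm]⟩))

theorem coe_thetaAlg_eq_iUnion :
    (thetaAlg K : Set (HeckeK K)) = ⋃ d ∈ {d : 𝓞 K | d ≠ 0}, (thetaSpan d : Set (HeckeK K)) := by
  ext f
  simp only [Set.mem_iUnion]
  constructor
  · intro hf
    obtain ⟨d, hd, h⟩ := exists_mem_thetaSpan ⟨f, hf⟩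
    exact ⟨d, hd, h⟩
  · rintro ⟨d, -, h⟩
    exact thetaSpanAlg_le_thetaAlg d h

end Levels

/-! ### Norm comparison and extension of *-homomorphisms into C*-algebras. -/

section CStar

/-- The range of `f` is finite-dimensional, hence a closed *-subalgebra of `C` and itself a
C*-algebra. Then `g` composed with the inverse of `f` is a *-homomorphism of C*-algebras, and these
are contractive. -/
theorem StarAlgHom.norm_apply_le_of_injective {S B C : Type*} [Ring S] [StarRing S] [Algebra ℂ S]
    [FiniteDimensional ℂ S] [CStarAlgebra B] [CStarAlgebra C] (f : S →⋆ₐ[ℂ] C)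
    (hf : Function.Injective f) (g : S →⋆ₐ[ℂ] B) (a : S) : ‖g a‖ ≤ ‖f a‖ := by
  have hfin : FiniteDimensional ℂ f.range.toSubalgebra.toSubmodule :=
    (LinearEquiv.ofInjective f.toAlgHom.toLinearMap hf).finiteDimensional
  -- Instance search uses this to make `f.range` a C*-algebra.
  have hcl : IsClosed (f.range : Set C) :=
    Submodule.closed_of_finiteDimensional f.range.toSubalgebra.toSubmodule
  let e := StarAlgEquiv.ofInjective f hf
  let ψ : f.range →⋆ₐ[ℂ] B := g.comp (e.symm : f.range →⋆ₐ[ℂ] S)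
  have h : ‖ψ (e a)‖ ≤ ‖e a‖ := NonUnitalStarAlgHom.norm_apply_le ψ (e a)
  have h1 : ψ (e a) = g a := congrArg g (e.symm_apply_apply a)
  rwa [h1] at h

/-- The algebra `A` carries no norm of its own. The bound makes `g` factor through the image of `j`,
and the factor extends by continuity; the algebraic identities are closed conditions and hold on a
dense set. -/
theorem StarAlgHom.exists_extension_of_denseRange {A B M : Type*} [Ring A] [StarRing A]
    [Algebra ℂ A] [CStarAlgebra B] [CStarAlgebra M] (j : A →⋆ₐ[ℂ] M) (hj : DenseRange j)
    (g : A →⋆ₐ[ℂ] B) (h : ∀ a, ‖g a‖ ≤ ‖j a‖) :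
    ∃ ψ : M →⋆ₐ[ℂ] B, ∀ a, ψ (j a) = g a := by
  let j' := j.toAlgHom.toLinearMap
  let g' := g.toAlgHom.toLinearMap
  let ψ : M →L[ℂ] B := g'.extendOfNorm j'
  have hψ : ∀ a, ψ (j a) = g a :=
    LinearMap.extendOfNorm_eq (f := g') (e := j') hj ⟨1, fun a => by rw [one_mul]; exact h a⟩
  have hc : Continuous ψ := ψ.continuous
  have h1 : ψ 1 = 1 := by rw [← map_one j, hψ, map_one]
  refine ⟨{ toFun := ψ
            map_one' := h1
            map_zero' := map_zero ψ
            map_add' := map_add ψ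
            map_mul' := fun x y => ?_
            commutes' := fun c => ?_
            map_star' := fun x => ?_ }, hψ⟩
  · refine hj.induction_on₂ (p := fun x y => ψ (x * y) = ψ x * ψ y) ?_ (fun a b => ?_) x y
    · exact isClosed_eq (by fun_prop) (by fun_prop)
    · rw [← map_mul, hψ, hψ, hψ, map_mul]
  · rw [Algebra.algebraMap_eq_smul_one, Algebra.algebraMap_eq_smul_one, map_smul, h1]
  · refine hj.induction_on (p := fun x => ψ (star x) = star (ψ x)) x ?_ fun a => ?_
    · exact isClosed_eq (by fun_prop) (by fun_prop)
    · rw [← map_star, hψ, hψ, map_star]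

theorem StarAlgHom.exists_extension_of_isClosed {A B C : Type*} [Ring A] [StarRing A]
    [Algebra ℂ A] [CStarAlgebra B] [CStarAlgebra C] (S : StarSubalgebra ℂ C)
    (hS : IsClosed (S : Set C)) (j : A →⋆ₐ[ℂ] S) (hj : DenseRange j)
    (g : A →⋆ₐ[ℂ] B) (h : ∀ a, ‖g a‖ ≤ ‖j a‖) :
    ∃ ψ : S →⋆ₐ[ℂ] B, ∀ a, ψ (j a) = g a :=
  letI := StarSubalgebra.cstarAlgebra S (h_closed := hS)
  StarAlgHom.exists_extension_of_denseRange j hj g h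

end CStar

/-! ### Characters, and the embedding of the group algebra in the group C*-algebra. -/

section GroupAlgebra

variable {D : Type u} [AddCommGroup D]

/-- The inclusion `ℚ/ℤ → ℝ/ℤ`. -/
noncomputable def ratCircleToReal : AddCircle (1 : ℚ) →+ AddCircle (1 : ℝ) :=
  QuotientAddGroup.map _ _ (Rat.castHom ℝ).toAddMonoidHom (by
    intro x hx
    obtain ⟨n, rfl⟩ := AddSubgroup.mem_zmultiples_iff.1 hx
    exact AddSubgroup.mem_zmultiples_iff.2 ⟨n, by simp⟩)

theorem ratCircleToReal_injective : Function.Injective ratCircleToReal := by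
  refine (injective_iff_map_eq_zero _).2 fun x hx => ?_
  obtain ⟨q, rfl⟩ := QuotientAddGroup.mk_surjective x
  have hx' : (((q : ℝ)) : AddCircle (1 : ℝ)) = 0 := hx
  obtain ⟨n, hn⟩ := (AddCircle.coe_eq_zero_iff _).1 hx'
  refine (AddCircle.coe_eq_zero_iff _).2 ⟨n, ?_⟩
  have : (n : ℝ) = (q : ℝ) := by simpa using hn
  rw [zsmul_one]
  exact_mod_cast this

/-- The value at `d` of the unitary character of `D` defined by `χ : D → ℚ/ℤ`. -/
noncomputable def characterValue (χ : CharacterModule D) (d : D) : ℂ :=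
  (AddCircle.toCircle (ratCircleToReal (χ d)) : ℂ)

theorem characterValue_add (χ : CharacterModule D) (d e : D) :
    characterValue χ (d + e) = characterValue χ d * characterValue χ e := by
  simp [characterValue, AddCircle.toCircle_add]

theorem characterValue_zero (χ : CharacterModule D) : characterValue χ 0 = 1 := by
  simp [characterValue]

theorem characterValue_neg (χ : CharacterModule D) (d : D) :
    characterValue χ (-d) = conj (characterValue χ d) := by
  rw [characterValue, map_neg, map_neg, AddCircle.toCircle_neg, Circle.coe_inv_eq_conj]
  rfl

/-- Evaluation of the group algebra at a character. -/
noncomputable def characterEval (χ : CharacterModule D) : AddMonoidAlgebra ℂ D →ₐ[ℂ] ℂ :=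
  AddMonoidAlgebra.lift ℂ ℂ D
    { toFun := fun d => characterValue χ d.toAdd
      map_one' := characterValue_zero χ
      map_mul' := fun _ _ => characterValue_add χ _ _ }

theorem characterEval_single (χ : CharacterModule D) (d : D) (c : ℂ) :
    characterEval χ (AddMonoidAlgebra.single d c) = c * characterValue χ d := by
  simp [characterEval]

theorem characterEval_star (χ : CharacterModule D) (a : AddMonoidAlgebra ℂ D) :
    characterEval χ (star a) = star (characterEval χ a) := by
  induction a using AddMonoidAlgebra.induction_linear with
  | zero => simp
  | add a b ha hb => simp only [map_add, star_add, ha, hb]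
  | single d c =>
    rw [GroupAlg.star_single, characterEval_single, characterEval_single, characterValue_neg]
    simp

/-- The C*-seminorm on the group algebra defined by a character. -/
noncomputable def characterSeminorm (χ : CharacterModule D) : CStarSeminorm D :=
  ⟨(normSeminorm ℂ ℂ).comp (characterEval χ).toLinearMap,
    fun a b => by simp,
    fun a => by simp [characterEval_star, sq]⟩

theorem characterSeminorm_apply (χ : CharacterModule D) (a : AddMonoidAlgebra ℂ D) :
    (characterSeminorm χ).1 a = ‖characterEval χ a‖ := rfl

/-- Dedekind's independence of characters with the roles exchanged: each `d` is a character of the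
dual group. Distinct elements give distinct characters because characters into `ℚ/ℤ` already
separate the points of any abelian group. -/
theorem linearIndependent_characterValue :
    LinearIndependent ℂ (fun (d : D) (χ : CharacterModule D) => characterValue χ d) := by
  let ev : D → (Multiplicative (CharacterModule D) →* ℂ) := fun d =>
    { toFun := fun χ => characterValue χ.toAdd d
      map_one' := by
        show (AddCircle.toCircle (ratCircleToReal 0) : ℂ) = 1
        rw [map_zero, AddCircle.toCircle_zero,
          Circle.coe_one]
      map_mul' := fun χ χ' => by
        show (AddCircle.toCircle (ratCircleToReal (χ.toAdd d + χ'.toAdd d)) : ℂ) = _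
        rw [map_add, AddCircle.toCircle_add,
          Circle.coe_mul]
        rfl }
  have hev : Function.Injective ev := by
    intro d e h
    refine sub_eq_zero.1 (CharacterModule.eq_zero_of_character_apply fun χ => ?_)
    have h' : characterValue χ d = characterValue χ e :=
      DFunLike.congr_fun h (Multiplicative.ofAdd χ)
    rw [map_sub, sub_eq_zero]
    exact ratCircleToReal_injective
      (AddCircle.injective_toCircle one_ne_zero (Circle.coe_injective h'))
  exact (linearIndependent_monoidHom (Multiplicative (CharacterModule D)) ℂ).comp ev hev

theorem eq_zero_of_characterEval {a : AddMonoidAlgebra ℂ D}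
    (h : ∀ χ : CharacterModule D, characterEval χ a = 0) : a = 0 := by
  have key : ∀ (b : AddMonoidAlgebra ℂ D) (χ : CharacterModule D), Finsupp.linearCombination ℂ
      (fun (d : D) (χ : CharacterModule D) => characterValue χ d) b.coeff χ =
        characterEval χ b := by
    intro b χ
    induction b using AddMonoidAlgebra.induction_linear with
    | zero => simp
    | add b b' hb hb' =>
      rw [AddMonoidAlgebra.coeff_add, map_add, Pi.add_apply, hb, hb', map_add]
    | single d c => rw [characterEval_single, AddMonoidAlgebra.coeff_single]; simp
  refine AddMonoidAlgebra.coeff_eq_zero.1 (linearIndependent_iff.1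
    linearIndependent_characterValue a.coeff (funext fun χ => ?_))
  rw [key, h]
  rfl

/-- The greatest C*-seminorm dominates `|χ(a)|` for every character `χ`, so an element of seminorm
zero is killed by all characters. -/
theorem GroupCStar.ofGroupAlg_injective : Function.Injective (GroupCStar.ofGroupAlg D) := by
  refine (injective_iff_map_eq_zero _).2 fun a ha => eq_zero_of_characterEval fun χ => ?_
  have h : maxCStarNorm a = 0 := by
    exact (GroupCStar.norm_ofPre (D := D) a).symm.trans ((congrArg norm ha).trans norm_zero)
  refine norm_le_zero_iff.1 ?_
  rw [← h, ← characterSeminorm_apply]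
  exact le_maxCStarNorm _ _

end GroupAlgebra

/-! ### Faithfulness of the Hecke representation and the norm on `A_θ`. -/

section HeckeRepresentation

/-- The value `f g` is a matrix coefficient: it is the entry of `λ(f)` applied to the basis vector
of the trivial coset, taken at the coset of `g`. -/
theorem heckeRep_injective {G : Type u} [Group G] {Γ : Subgroup G} [IsHeckePair Γ] :
    Function.Injective (heckeRep Γ) := by
  classical
  refine (injective_iff_map_eq_zero _).2 fun f hf => HeckeAlgebra.ext fun g => ?_
  have h : heckeOp f = 0 := hf
  -- The chosen representative of the trivial coset need not be `1`; its inverse lies in `Γ` and is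
  -- absorbed by right invariance.
  have h1 : mkRightCoset Γ (mkRightCoset Γ (1 : G)).out = mkRightCoset Γ 1 := Quotient.out_eq _
  rw [mkRightCoset_eq_iff, one_mul] at h1
  have h2 := heckeOp_single f (mkRightCoset Γ 1) (mkRightCoset Γ g) 1
  rw [h, f.isHeckeFun.right_inv _ h1, out_mkRightCoset f.isHeckeFun.left_inv, mul_one] at h2
  exact h2.symm

variable {K : Type u} [Field K] [NumberField K]

/-- The restriction of the Hecke representation to `𝔄`, as a map into `A_θ`. -/
noncomputable def thetaRep : thetaAlg K →⋆ₐ[ℂ] thetaCStar K :=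
  StarAlgHom.codRestrict ((heckeRep (intAffGroup K)).comp (thetaAlg K).subtype) (thetaCStar K)
    fun f => StarSubalgebra.le_topologicalClosure _ ⟨f, f.2, rfl⟩

theorem thetaRep_thetaGen (r : KModO K) : thetaRep (thetaGen r) = thetaCStarGen r := rfl

theorem thetaRep_injective : Function.Injective (thetaRep (K := K)) := fun _ _ h =>
  Subtype.ext (heckeRep_injective (congrArg Subtype.val h))

theorem denseRange_thetaRep : DenseRange (thetaRep (K := K)) := by
  intro x
  rw [closure_subtype]
  refine closure_mono ?_ x.2
  rintro _ ⟨f, hf, rfl⟩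
  exact ⟨thetaRep ⟨f, hf⟩, ⟨_, rfl⟩, rfl⟩

theorem thetaCStar_le_heckeCStar : thetaCStar K ≤ heckeCStar (intAffGroup K) := by
  refine StarSubalgebra.topologicalClosure_mono ?_
  rintro _ ⟨f, -, rfl⟩
  exact ⟨f, rfl⟩

theorem thetaRelations_thetaCStarGen : ThetaRelations (thetaCStarGen (K := K)) :=
  ThetaRelations.of_injective (thetaCStar K).subtype Subtype.val_injective
    (thetaRelations_theta.map (heckeRep (intAffGroup K)))

instance : IsClosed (thetaCStar K : Set (HeckeL2 (intAffGroup K) →L[ℂ] HeckeL2 (intAffGroup K))) :=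
  StarSubalgebra.isClosed_topologicalClosure _

/-- Each element lies in some finite-dimensional level, where the comparison is available. Thus
every faithful representation in a C*-algebra realises the greatest C*-norm on `𝔄`. -/
theorem norm_apply_le_of_injective_thetaAlg {B C : Type*} [CStarAlgebra B] [CStarAlgebra C]
    (f : thetaAlg K →⋆ₐ[ℂ] C) (hf : Function.Injective f) (g : thetaAlg K →⋆ₐ[ℂ] B)
    (a : thetaAlg K) : ‖g a‖ ≤ ‖f a‖ := by
  obtain ⟨d, hd, h⟩ := exists_mem_thetaSpan a
  have : FiniteDimensional ℂ (thetaSpanAlg d) := finiteDimensional_thetaSpan hd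
  let i := StarSubalgebra.inclusion (thetaSpanAlg_le_thetaAlg d)
  exact StarAlgHom.norm_apply_le_of_injective (f.comp i)
    (hf.comp (StarSubalgebra.inclusion_injective (thetaSpanAlg_le_thetaAlg d))) (g.comp i) ⟨a, h⟩

theorem exists_thetaCStar_hom {B : Type*} [CStarAlgebra B] (g : thetaAlg K →⋆ₐ[ℂ] B) :
    ∃ φ : thetaCStar K →⋆ₐ[ℂ] B, ∀ a, φ (thetaRep a) = g a :=
  StarAlgHom.exists_extension_of_isClosed (thetaCStar K)
    (StarSubalgebra.isClosed_topologicalClosure _) thetaRep denseRange_thetaRep g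
    (norm_apply_le_of_injective_thetaAlg _ thetaRep_injective g)

theorem thetaCStar_hom_ext {B : Type*} [CStarAlgebra B] {φ ψ : thetaCStar K →⋆ₐ[ℂ] B}
    (h : ∀ r, φ (thetaCStarGen r) = ψ (thetaCStarGen r)) : φ = ψ := by
  have hφ : Continuous φ :=
    AddMonoidHomClass.continuous_of_bound φ 1 (by simpa using NonUnitalStarAlgHom.norm_apply_le φ)
  have hψ : Continuous ψ :=
    AddMonoidHomClass.continuous_of_bound ψ 1 (by simpa using NonUnitalStarAlgHom.norm_apply_le ψ)
  have e : φ.comp thetaRep = ψ.comp thetaRep := thetaAlg_hom_ext h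
  exact DFunLike.coe_injective
    (denseRange_thetaRep.equalizer hφ hψ (funext fun a => DFunLike.congr_fun e a))

/-- On `𝔄` the two faithful representations dominate each other in norm; density and continuity
carry the equality to `A_θ`. Injectivity on `𝔄` alone therefore suffices, although passing to a
closure can in general destroy injectivity. -/
theorem isometry_of_injective_comp_thetaRep {B : Type*} [CStarAlgebra B]
    (ψ : thetaCStar K →⋆ₐ[ℂ] B) (hinj : Function.Injective (ψ.comp thetaRep)) : Isometry ψ := by
  have hψ : Continuous ψ :=
    AddMonoidHomClass.continuous_of_bound ψ 1 (by simpa using NonUnitalStarAlgHom.norm_apply_le ψ)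
  refine AddMonoidHomClass.isometry_of_norm ψ fun x => ?_
  refine denseRange_thetaRep.induction_on (p := fun x => ‖ψ x‖ = ‖x‖) x
    (isClosed_eq hψ.norm continuous_norm) fun a => ?_
  exact le_antisymm (norm_apply_le_of_injective_thetaAlg _ thetaRep_injective (ψ.comp thetaRep) a)
    (norm_apply_le_of_injective_thetaAlg (ψ.comp thetaRep) hinj thetaRep a)

end HeckeRepresentation

theorem mainTheorem8 (K : Type u) [Field K] [NumberField K] :
    -- (1) `𝔄` is universal for the relations, has the `θ_r` as a linear basis, and is commutative
    (ThetaRelations (thetaGen (K := K)) ∧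
      (∀ (B : Type v) [Ring B] [StarRing B] [Algebra ℂ B] [StarModule ℂ B] (x : KModO K → B),
        ThetaRelations x → ∃! φ : thetaAlg K →⋆ₐ[ℂ] B, ∀ r, φ (thetaGen r) = x r) ∧
      (∃ b : Module.Basis (MulAction.orbitRel.Quotient (𝓞 K)ˣ (KModO K)) ℂ (thetaAlg K),
        ∀ r : KModO K, b (Quotient.mk'' r) = thetaGen r) ∧
      (∀ f g : thetaAlg K, f * g = g * f)) ∧
    -- (2) `𝔄` is the union of the finite-dimensional subalgebras `𝔄(d)`
    ((∀ d : 𝓞 K, d ≠ 0 → FiniteDimensional ℂ (thetaSpan d) ∧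
        ∃ S : StarSubalgebra ℂ (HeckeK K), S.toSubalgebra.toSubmodule = thetaSpan d) ∧
      (thetaAlg K : Set (HeckeK K)) = ⋃ d ∈ {d : 𝓞 K | d ≠ 0}, (thetaSpan d : Set (HeckeK K))) ∧
    -- (3) `𝔄` embeds in the Hecke C*-algebra, and the C*-subalgebra `A_θ` it generates there is
    -- universal for the relations in the category of (unital) C*-algebras
    (Set.InjOn (heckeRep (intAffGroup K)) (thetaAlg K) ∧
      thetaCStar K ≤ heckeCStar (intAffGroup K) ∧
      ThetaRelations (thetaCStarGen (K := K)) ∧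
      (∀ (B : Type w) [CStarAlgebra B] (x : KModO K → B),
        ThetaRelations x → ∃! φ : thetaCStar K →⋆ₐ[ℂ] B, ∀ r, φ (thetaCStarGen r) = x r)) ∧
    -- (4) unit-orbit averages embed `𝔄` in `ℂ[K/𝓞]` and `A_θ` in `C*(K/𝓞)`
    ((∃ φ : thetaAlg K →⋆ₐ[ℂ] AddMonoidAlgebra ℂ (KModO K),
        (∀ r, φ (thetaGen r) = orbitAverage r) ∧ Function.Injective φ ∧
        ∀ φ' : thetaAlg K →⋆ₐ[ℂ] AddMonoidAlgebra ℂ (KModO K),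
          (∀ r, φ' (thetaGen r) = orbitAverage r) → φ' = φ) ∧
      (∃ ψ : thetaCStar K →⋆ₐ[ℂ] GroupCStar (KModO K),
        (∀ r, ψ (thetaCStarGen r) = GroupCStar.ofGroupAlg (KModO K) (orbitAverage r)) ∧
        Isometry ψ ∧
        ∀ ψ' : thetaCStar K →⋆ₐ[ℂ] GroupCStar (KModO K),
          (∀ r, ψ' (thetaCStarGen r) = GroupCStar.ofGroupAlg (KModO K) (orbitAverage r)) →
            ψ' = ψ)) := by

  refine ⟨⟨thetaRelations_thetaGen, fun B _ _ _ _ x hx => ?_, exists_basis_thetaGen K,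
      thetaAlg_mul_comm⟩,
    ⟨fun d hd => ⟨finiteDimensional_thetaSpan hd, thetaSpanAlg d, thetaSpanAlg_toSubmodule d⟩,
      coe_thetaAlg_eq_iUnion⟩,
    ⟨heckeRep_injective.injOn, thetaCStar_le_heckeCStar, thetaRelations_thetaCStarGen,
      fun B _ x hx => ?_⟩,
    ⟨thetaLift (thetaRelations_orbitAverage (K := K)), thetaLift_thetaGen _,
      thetaLift_orbitAverage_injective, fun φ' h => thetaAlg_hom_ext fun r => ?_⟩, ?_⟩
  · exact ⟨thetaLift hx, thetaLift_thetaGen hx, fun φ h => thetaAlg_hom_ext fun r => by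
      rw [h, thetaLift_thetaGen]⟩
  · obtain ⟨φ, hφ⟩ := exists_thetaCStar_hom (thetaLift hx)
    have hφ' : ∀ r, φ (thetaCStarGen r) = x r := fun r => by
      rw [← thetaRep_thetaGen, hφ, thetaLift_thetaGen]
    exact ⟨φ, hφ', fun φ' h => thetaCStar_hom_ext fun r => by rw [h, hφ']⟩
  · rw [h, thetaLift_thetaGen]
  · obtain ⟨ψ, hψ⟩ := exists_thetaCStar_hom
      ((GroupCStar.ofGroupAlg (KModO K)).comp (thetaLift (thetaRelations_orbitAverage (K := K))))
    have hψ' : ∀ r, ψ (thetaCStarGen r) = GroupCStar.ofGroupAlg (KModO K) (orbitAverage r) :=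
      fun r => by
        rw [← thetaRep_thetaGen, hψ, StarAlgHom.comp_apply, thetaLift_thetaGen]
    refine ⟨ψ, hψ', isometry_of_injective_comp_thetaRep ψ ?_, fun ψ' h =>
      thetaCStar_hom_ext fun r => by rw [h, hψ']⟩
    -- On `𝔄` the map is the orbit-average embedding followed by the embedding of `ℂ[K/𝓞]` in its
    -- C*-completion, so it is injective there.
    have e : ⇑(ψ.comp thetaRep) = GroupCStar.ofGroupAlg (KModO K) ∘
        thetaLift (thetaRelations_orbitAverage (K := K)) := funext hψ
    rw [e]
    exact GroupCStar.ofGroupAlg_injective.comp thetaLift_orbitAverage_injective
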